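/- Let $I$ be a finite set of agents and $\Phi$ a countable set of atoms, and let $\mathcal L$ be the language $\varphi ::= \top \mid p \mid \neg\varphi \mid \varphi\wedge\varphi \mid \square_i\varphi$ ($p\in\Phi$, $i\in I$). A logic $\Lambda$ is an extension of the minimal normal modal logic $K$ over $\mathcal L$ that is closed under modus ponens and necessitation. For a set $X$ of pointed Kripke models (with countably many states), the modal space $\boldsymbol X$ is $X$ modulo modal equivalence, with the Stone topology generated by the sets $\{\boldsymbol x : x\vDash\varphi\}$, $\varphi\in\mathcal L$. A multi-pointed action model $\Sigma_\Gamma$ consists of a countable non-empty set of actions, an accessibility relation $\mathsf R_i$ on actions for each agent $i$, a precondition $pre(\sigma)\in\mathcal L$ and a postcondition $post(\sigma)$ (either $\top$ or a conjunction of literals) for each action $\sigma$, and a non-empty set $\Gamma$ of designated actions. It is Boolean if no precondition contains a modal operator, and static if all postconditions are $\top$. The product update $x\otimes\Sigma_\Gamma$ of $x=Ms$ has as states the pairs $(t,\sigma)$ with $Mt\vDash pre(\sigma)$, with $(t,\sigma)R'_i(u,\tau)$ iff $tR_iu$ and $\sigma\mathsf R_i\tau$; the atom $p$ is true at $(t,\sigma)$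 iff $post(\sigma)\vDash p$, or $p$ is true at $t$ and $post(\sigma)\nvDash\neg p$; the designated state is $(s,\sigma)$ for the $\sigma\in\Gamma$ with $x\vDash pre(\sigma)$. A map $\boldsymbol f:\boldsymbol X\to\boldsymbol X$ is a clean map based on $\Sigma_\Gamma$ if the preconditions of $\Sigma_\Gamma$ are finitely many up to $\Lambda$-provable equivalence, every $x\in X$ satisfies $pre(\sigma)$ for exactly one $\sigma\in\Gamma$, $x\otimes\Sigma_\Gamma\in X$ for all $x\in X$, and $\boldsymbol f$ sends the class of $x$ to the class of $x\otimes\Sigma_\Gamma$ for all $x\in X$. We call $\boldsymbol f$ Boolean or static if $\Sigma_\Gamma$ is. The orbit $\mathcal O_{\boldsymbol f}(\boldsymbol x)=\{\boldsymbol f^n(\boldsymbol x):n\ge 0\}$ is periodic if $\boldsymbol f^{n+k}(\boldsymbol x)=\boldsymbol f^n(\boldsymbol x)$ for some $n\ge0$, $k>0$. The limit set $\omega_{\boldsymbol f}(\boldsymbol y)$ is the set of limits of convergent subsequences of $(\boldsymbol f^n(\boldsymbol y))_{n\ge0}$. A limit cycle of $\boldsymbol f$ is a periodic orbit $\mathcal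 O_{\boldsymbol f}(\boldsymbol x)$ with $\mathcal O_{\boldsymbol f}(\boldsymbol x)=\omega_{\boldsymbol f}(\boldsymbol y)$ for some $\boldsymbol y\in\boldsymbol X\setminus\mathcal O_{\boldsymbol f}(\boldsymbol x)$. A finite presentation is a pair $(\Sigma_\Gamma,x_0)$ of a finite multi-pointed action model and a finite pointed Kripke model, over finite $I$ and $\Phi$. It presents the map based on $\Sigma_\Gamma$ on the modal space of $X=\{x_0,\ x_0\otimes\Sigma_\Gamma,\ (x_0\otimes\Sigma_\Gamma)\otimes\Sigma_\Gamma,\dots\}$, provided that this is a clean map. **Proposition (undecidability).** There are a finite set of agents and a finite set of atoms such that, for every logic $\Lambda$ over the resulting language, for each of the two classes of clean maps 1. Boolean and non-static, 2. static and non-Boolean, and for each of the two questions a) does the map have a periodic orbit? b) does the map contain a limit cycle? the problem is undecidable, already for finitely presented maps: there is no algorithm that, given any finite presentation of a clean map in the class, halts and answers the question correctly. (The algorithm may do anything on inputs that do not present a clean map in the class.) -/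

import Mathlib

open Filter Topology

namespace CleanMaps

/-! ### Language, logics and Kripke models -/

/-- The modal language over agents `I` and atoms `Φ`. -/
inductive Formula (I Φ : Type) : Type
  | top : Formula I Φ
  | atom : Φ → Formula I Φ
  | neg : Formula I Φ → Formula I Φ
  | and : Formula I Φ → Formula I Φ → Formula I Φ
  | box : I → Formula I Φ → Formula I Φ

namespace Formula

variable {I Φ : Type}

/-- Material implication. -/
def imp (φ ψ : Formula I Φ) : Formula I Φ := neg (and φ (neg ψ))

/-- Material equivalence. -/
def iff (φ ψ : Formula I Φ) : Formula I Φ := and (imp φ ψ) (imp ψ φ)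

/-- Formulas without modal operators. -/
def IsBoolean : Formula I Φ → Prop
  | top => True
  | atom _ => True
  | neg φ => φ.IsBoolean
  | and φ ψ => φ.IsBoolean ∧ ψ.IsBoolean
  | box _ _ => False

/-- Conjunctions of literals. -/
inductive IsClause : Formula I Φ → Prop
  | pos (p : Φ) : IsClause (atom p)
  | negative (p : Φ) : IsClause (neg (atom p))
  | conj {φ ψ : Formula I Φ} : IsClause φ → IsClause ψ → IsClause (and φ ψ)

/-- `φ` is true under every assignment of truth values to formulas that respects the
propositional connectives. -/
def IsTautology (φ : Formula I Φ) : Prop :=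
  ∀ v : Formula I Φ → Prop, v top → (∀ ψ, v (neg ψ) ↔ ¬ v ψ) →
    (∀ ψ χ, v (and ψ χ) ↔ v ψ ∧ v χ) → v φ

end Formula

/-- Logics: extensions of the minimal normal modal logic `K`, closed under modus ponens and
necessitation. (Closure under uniform substitution may hold but is not demanded.) -/
structure IsLogic {I Φ : Type} (Λ : Set (Formula I Φ)) : Prop where
  tautology : ∀ φ, φ.IsTautology → φ ∈ Λ
  axiomK : ∀ (i : I) (φ ψ : Formula I Φ),
    ((Formula.box i (φ.imp ψ)).imp ((Formula.box i φ).imp (Formula.box i ψ))) ∈ Λ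
  modusPonens : ∀ φ ψ : Formula I Φ, φ.imp ψ ∈ Λ → φ ∈ Λ → ψ ∈ Λ
  necessitation : ∀ (i : I) (φ : Formula I Φ), φ ∈ Λ → Formula.box i φ ∈ Λ

/-- The `Λ`-proposition of `φ`: all formulas `Λ`-provably equivalent to `φ`. -/
def proposition {I Φ : Type} (Λ : Set (Formula I Φ)) (φ : Formula I Φ) : Set (Formula I Φ) :=
  {ψ | φ.iff ψ ∈ Λ}

/-- Pointed Kripke models with a countable set of states. -/
structure PointedModel (I Φ : Type) : Type 1 where
  State : Type
  countable : Countable State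
  R : I → State → State → Prop
  V : Φ → State → Prop
  point : State

namespace PointedModel

variable {I Φ : Type}

/-- Truth of a formula at a state of (the Kripke model underlying) `M`. -/
def SatAt (M : PointedModel I Φ) : M.State → Formula I Φ → Prop
  | _, .top => True
  | s, .atom p => M.V p s
  | s, .neg φ => ¬ M.SatAt s φ
  | s, .and φ ψ => M.SatAt s φ ∧ M.SatAt s ψ
  | s, .box i φ => ∀ t, M.R i s t → M.SatAt t φ

/-- Truth of a formula at a pointed Kripke model. -/
def Sat (M : PointedModel I Φ) (φ : Formula I Φ) : Prop := M.SatAt M.point φ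

end PointedModel

/-- Semantic consequence over all pointed Kripke models. -/
def Formula.Entails {I Φ : Type} (φ ψ : Formula I Φ) : Prop :=
  ∀ x : PointedModel I Φ, x.Sat φ → x.Sat ψ

/-! ### Modal spaces -/

/-- Modal equivalence on a set of pointed Kripke models. -/
def modalSetoid {I Φ : Type} (X : Set (PointedModel I Φ)) : Setoid X where
  r x y := ∀ φ : Formula I Φ, x.1.Sat φ ↔ y.1.Sat φ
  iseqv :=
    ⟨fun _ _ => Iff.rfl, fun h φ => (h φ).symm, fun h₁ h₂ φ => (h₁ φ).trans (h₂ φ)⟩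

/-- The modal space of `X`: pointed Kripke models in `X` modulo modal equivalence. -/
def ModalSpace {I Φ : Type} (X : Set (PointedModel I Φ)) : Type 1 :=
  Quotient (modalSetoid X)

namespace ModalSpace

variable {I Φ : Type} {X : Set (PointedModel I Φ)}

/-- The point of the modal space given by `x ∈ X`. -/
def mk (x : PointedModel I Φ) (hx : x ∈ X) : ModalSpace X :=
  Quotient.mk (modalSetoid X) ⟨x, hx⟩

/-- Truth of a formula at a point of a modal space. -/
def Sat (x : ModalSpace X) (φ : Formula I Φ) : Prop :=
  Quotient.lift (s := modalSetoid X) (fun y => y.1.Sat φ) (fun _ _ h => propext (h φ)) x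

/-- The Stone topology, generated by the sets of points satisfying a given formula. -/
instance : TopologicalSpace (ModalSpace X) :=
  TopologicalSpace.generateFrom {U | ∃ φ : Formula I Φ, U = {x | x.Sat φ}}

end ModalSpace

/-! ### Action models, product update and clean maps -/

/-- Multi-pointed action models; `designated` is the set of designated actions. -/
structure ActionModel (I Φ : Type) : Type 1 where
  Action : Type
  countable : Countable Action
  R : I → Action → Action → Prop
  pre : Action → Formula I Φ
  post : Action → Formula I Φ
  post_wf : ∀ σ, post σ = .top ∨ (post σ).IsClause
  designated : Set Action
  designated_nonempty : designated.Nonempty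

namespace ActionModel

variable {I Φ : Type}

/-- The product of `x` and `A`, with designated state `(s, σ)` for `s` the designated state of
`x` and `σ` a given action executable at `x`. -/
def product (A : ActionModel I Φ) (x : PointedModel I Φ) (σ : A.Action)
    (h : x.Sat (A.pre σ)) : PointedModel I Φ where
  State := {a : x.State × A.Action // x.SatAt a.1 (A.pre a.2)}
  countable := by
    have := x.countable
    have := A.countable
    infer_instance
  R i a b := x.R i a.1.1 b.1.1 ∧ A.R i a.1.2 b.1.2
  V p a := (x.V p a.1.1 ∧ ¬ (A.post a.1.2).Entails (.neg (.atom p))) ∨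
    (A.post a.1.2).Entails (.atom p)
  point := ⟨(x.point, σ), h⟩

open Classical in
/-- The product update `x ⊗ A`, whose designated state is `(s, σ)` for a designated action `σ`
executable at `x`. It is only used for `A` exhaustive and deterministic, when this action exists
and is unique; otherwise an arbitrary such action is taken, and `x` is left unchanged if there is
none. -/
noncomputable def update (A : ActionModel I Φ) (x : PointedModel I Φ) : PointedModel I Φ :=
  if h : ∃ σ, σ ∈ A.designated ∧ x.Sat (A.pre σ) then A.product x h.choose h.choose_spec.2
  else x

/-- The preconditions represent only finitely many `Λ`-propositions. -/
def PreconditionFinite (A : ActionModel I Φ) (Λ : Set (Formula I Φ)) : Prop :=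
  (Set.range fun σ => proposition Λ (A.pre σ)).Finite

def ExhaustiveOver (A : ActionModel I Φ) (X : Set (PointedModel I Φ)) : Prop :=
  ∀ x ∈ X, ∃ σ ∈ A.designated, x.Sat (A.pre σ)

def DeterministicOver (A : ActionModel I Φ) (X : Set (PointedModel I Φ)) : Prop :=
  ∀ σ ∈ A.designated, ∀ σ' ∈ A.designated, σ ≠ σ' →
    ∀ x ∈ X, ¬ (x.Sat (A.pre σ) ∧ x.Sat (A.pre σ'))

def ClosingOver (A : ActionModel I Φ) (X : Set (PointedModel I Φ)) : Prop :=
  ∀ x ∈ X, A.update x ∈ X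

/-- All preconditions are Boolean formulas. -/
def IsBoolean (A : ActionModel I Φ) : Prop := ∀ σ, (A.pre σ).IsBoolean

/-- All postconditions are `⊤`. -/
def IsStatic (A : ActionModel I Φ) : Prop := ∀ σ, A.post σ = .top

end ActionModel

/-- `f` is a clean map on the modal space of `X`, based on the action model `A`. -/
structure IsCleanMapBasedOn {I Φ : Type} (Λ : Set (Formula I Φ)) (A : ActionModel I Φ)
    (X : Set (PointedModel I Φ)) (f : ModalSpace X → ModalSpace X) : Prop where
  preconditionFinite : A.PreconditionFinite Λ
  exhaustive : A.ExhaustiveOver X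
  deterministic : A.DeterministicOver X
  closing : A.ClosingOver X
  map_eq : ∀ (x : PointedModel I Φ) (hx : x ∈ X),
    f (ModalSpace.mk x hx) = ModalSpace.mk (A.update x) (closing x hx)

/-! ### Orbits, limit sets and limit cycles -/

section Dynamics

variable {α : Type*}

/-- The orbit of `x` under `f`. -/
def orbit (f : α → α) (x : α) : Set α := Set.range fun n : ℕ => f^[n] x

/-- The orbit of `x` under `f` is periodic (equivalently, finite). -/
def IsPeriodicOrbit (f : α → α) (x : α) : Prop :=
  ∃ n k : ℕ, 0 < k ∧ f^[n + k] x = f^[n] x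

/-- The limit set of `x` under `f`: limits of subsequences of the sequence of iterates. -/
def limitSet [TopologicalSpace α] (f : α → α) (x : α) : Set α :=
  {y | ∃ n : ℕ → ℕ, StrictMono n ∧ Tendsto (fun j => f^[n j] x) atTop (𝓝 y)}

/-- Some orbit of `f` is periodic. -/
def HasPeriodicOrbit (f : α → α) : Prop := ∃ x, IsPeriodicOrbit f x

/-- Some periodic orbit of `f` is the limit set of a point outside that orbit. -/
def HasLimitCycle [TopologicalSpace α] (f : α → α) : Prop :=
  ∃ x, IsPeriodicOrbit f x ∧ ∃ y, y ∉ orbit f x ∧ orbit f x = limitSet f y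

end Dynamics

/-! ### Finite presentations and their codes -/

/-- A Gödel number of a formula over finitely many agents and atoms. -/
def Formula.code {k m : ℕ} : Formula (Fin k) (Fin m) → ℕ
  | .top => Nat.pair 0 0
  | .atom p => Nat.pair 1 p
  | .neg φ => Nat.pair 2 φ.code
  | .and φ ψ => Nat.pair 3 (Nat.pair φ.code ψ.code)
  | .box i φ => Nat.pair 4 (Nat.pair i φ.code)

theorem Formula.code_injective {k m : ℕ} :
    Function.Injective (Formula.code : Formula (Fin k) (Fin m) → ℕ) := by
  intro φ
  induction φ with
  | top => intro ψ h; cases ψ <;> simp_all [Formula.code, Nat.pair_eq_pair]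
  | atom p =>
    intro ψ h
    cases ψ <;> simp_all [Formula.code, Nat.pair_eq_pair, Fin.ext_iff]
  | neg φ ih =>
    intro ψ h
    cases ψ <;> simp only [Formula.code, Nat.pair_eq_pair] at h <;> first | omega | skip
    rw [ih h.2]
  | and φ ψ ih₁ ih₂ =>
    intro χ h
    cases χ <;> simp only [Formula.code, Nat.pair_eq_pair] at h <;> first | omega | skip
    rw [ih₁ h.2.1, ih₂ h.2.2]
  | box i φ ih =>
    intro ψ h
    cases ψ <;> simp only [Formula.code, Nat.pair_eq_pair] at h <;> first | omega | skip
    rw [ih h.2.2, Fin.ext h.2.1]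

/-- A finite pointed Kripke model, given by finite data: its states are `0, …, last`, state `t` is
accessible from state `s` for agent `i` if `(i, s, t)` is listed in `edges`, and atom `p` is true
at state `s` if `(p, s)` is listed in `labels`. -/
structure FinModel (k m : ℕ) : Type where
  last : ℕ
  edges : List (Fin k × ℕ × ℕ)
  labels : List (Fin m × ℕ)
  point : Fin (last + 1)

/-- The pointed Kripke model given by finite data. -/
def FinModel.toPointedModel {k m : ℕ} (M : FinModel k m) : PointedModel (Fin k) (Fin m) where
  State := Fin (M.last + 1)
  countable := inferInstance
  R i s t := (i, (s : ℕ), (t : ℕ)) ∈ M.edges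
  V p s := (p, (s : ℕ)) ∈ M.labels
  point := M.point

/-- A finite multi-pointed action model, given by finite data: its actions are `0, …, last`, and
the relations are listed as for finite Kripke models. -/
structure FinActionModel (k m : ℕ) : Type where
  last : ℕ
  edges : List (Fin k × ℕ × ℕ)
  pre : Fin (last + 1) → Formula (Fin k) (Fin m)
  post : Fin (last + 1) → Formula (Fin k) (Fin m)
  post_wf : ∀ σ, post σ = .top ∨ (post σ).IsClause
  designated : List (Fin (last + 1))
  designated_ne_nil : designated ≠ []

/-- The multi-pointed action model given by finite data. -/
def FinActionModel.toActionModel {k m : ℕ} (A : FinActionModel k m) :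
    ActionModel (Fin k) (Fin m) where
  Action := Fin (A.last + 1)
  countable := inferInstance
  R i σ τ := (i, (σ : ℕ), (τ : ℕ)) ∈ A.edges
  pre := A.pre
  post := A.post
  post_wf := A.post_wf
  designated := {σ | σ ∈ A.designated}
  designated_nonempty := List.exists_mem_of_ne_nil _ A.designated_ne_nil

/-- A finite presentation: a finite multi-pointed action model and a finite pointed Kripke model,
the initial model. -/
structure Presentation (k m : ℕ) : Type where
  action : FinActionModel k m
  initial : FinModel k m

namespace Presentation

variable {k m : ℕ}

/-- The presented set of pointed Kripke models: the least set that contains the initial model and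
is closed under product update with the action model. -/
def models (P : Presentation k m) : Set (PointedModel (Fin k) (Fin m)) :=
  Set.range fun n : ℕ => P.action.toActionModel.update^[n] P.initial.toPointedModel

/-- The natural number that is given to an algorithm as its input: all the data of the
presentation, under the standard codes of lists and tuples. -/
def code (P : Presentation k m) : ℕ :=
  Encodable.encode
    ((P.action.last, P.action.edges,
      List.ofFn fun σ => (P.action.pre σ).code,
      List.ofFn fun σ => (P.action.post σ).code,
      P.action.designated.map Fin.val),
     (P.initial.last, P.initial.edges, P.initial.labels, (P.initial.point : ℕ)))

theorem code_injective : Function.Injective (code : Presentation k m → ℕ) := by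
  rintro ⟨⟨l, e, pr, po, w, g, hg⟩, ⟨l', e', v, p⟩⟩
    ⟨⟨l₂, e₂, pr₂, po₂, w₂, g₂, hg₂⟩, ⟨l₂', e₂', v₂, p₂⟩⟩ h
  have h := Encodable.encode_injective h
  simp only [Prod.mk.injEq] at h
  obtain ⟨⟨rfl, rfl, h₁, h₂, h₃⟩, rfl, rfl, rfl, h₄⟩ := h
  have h₁ := List.ofFn_injective h₁
  have h₂ := List.ofFn_injective h₂
  have h₃ := (List.map_injective_iff.2 Fin.val_injective) h₃
  have e₁ : pr = pr₂ := funext fun σ => Formula.code_injective (congrFun h₁ σ)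
  have e₂ : po = po₂ := funext fun σ => Formula.code_injective (congrFun h₂ σ)
  have e₄ : p = p₂ := Fin.ext h₄
  subst e₁ e₂ h₃ e₄
  rfl

end Presentation

/-- The problem of deciding whether clean maps have property `Q`, for clean maps that are based on
an action model in the class `C` and presented by finite data, is decidable: there is an algorithm
which, given the code of a presentation of such a clean map, halts and tells whether the map has
property `Q`. Nothing is asked of the algorithm on other inputs. -/
def DecidableForCleanMaps {k m : ℕ} (Λ : Set (Formula (Fin k) (Fin m)))
    (C : ActionModel (Fin k) (Fin m) → Prop)
    (Q : ∀ X : Set (PointedModel (Fin k) (Fin m)), (ModalSpace X → ModalSpace X) → Prop) :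
    Prop :=
  ∃ d : ℕ →. Bool, Partrec d ∧
    ∀ (P : Presentation k m) (f : ModalSpace P.models → ModalSpace P.models),
      C P.action.toActionModel →
      IsCleanMapBasedOn Λ P.action.toActionModel P.models f →
      (Q P.models f → true ∈ d P.code) ∧ (¬ Q P.models f → false ∈ d P.code)

end CleanMaps

namespace CleanMaps

open Turing

/-! The run of a Turing machine is encoded in the iterates of a product update. A finite machine
whose halting problem is undecidable on the inputs `x₀ x₁ x₂ … x₂`
(`exists_machine_halting_undecidable`) is simulated by a cellular automaton whose cells see only
themselves and two cells to their left. The tape drifts one cell to the right in each step, so that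
a one-sided rule still sees both old neighbours of the cell being computed. When the machine halts,
a wall of halted cells spreads to the right until it meets the never visited cells; then it stands
still, the tape on its left drifts into it and is replaced by blanks, and the word becomes constant
in time. If the machine does not halt, the border of the never visited cells advances forever and no
word recurs. This gives `exists_oneSided_undecidable`.

A word becomes an infinite path that starts at its first letter, and one-sidedness is what product
update can handle: an action is a window of three letters, its precondition tests the last letter,
and overlaps carry the other two along the arrows. In the Boolean case letters are atoms, rewritten
by postconditions (`labelledAction_update`). In the static case a letter is the agent of an arrow to
a terminal state, read by a modal precondition and rewritten by the arrows of the action model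
(`pointerAction_update`). Input words are eventually constant, so their paths are bisimilar to
finite models.

The presented modal space is a single forward orbit. If the run becomes constant, it ends in a fixed
point, which is the limit of the initial point and different from it; otherwise all its points are
distinct (`cleanMap_dichotomy`). So an answer to either question would decide halting
(`not_decidableForCleanMaps`). -/

/-! ### Halting on inputs of a simple shape -/

theorem not_computablePred_dom_decode :
    ¬ ComputablePred fun k : ℕ =>
      (Nat.Partrec.Code.eval (Denumerable.ofNat Nat.Partrec.Code k) 0).Dom := by
  intro h
  refine ComputablePred.halting_problem 0 ?_
  obtain ⟨_, h⟩ := h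
  refine ⟨Classical.decPred _, (h.comp Computable.encode).of_eq fun c => ?_⟩
  simp

/-- A partial recursive function that runs the `k`-th program on input `2 ^ k`. -/
theorem exists_partrec_two_pow :
    ∃ f : ℕ →. ℕ, Partrec f ∧
      ∀ k, (f (2 ^ k)).Dom ↔
        (Nat.Partrec.Code.eval (Denumerable.ofNat Nat.Partrec.Code k) 0).Dom := by
  refine ⟨fun m => (Nat.rfind fun k => Part.some (decide (2 ^ k = m))).bind fun k =>
    Nat.Partrec.Code.eval (Denumerable.ofNat Nat.Partrec.Code k) 0, ?_, fun k => ?_⟩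
  · have hpow : Primrec fun k : ℕ => 2 ^ k := by
      refine (Primrec.nat_rec₁ 1 (Primrec.nat_mul.comp (Primrec.const 2) Primrec.snd).to₂).of_eq
        fun k => ?_
      induction k with
      | zero => rfl
      | succ k ih => simp only [ih, pow_succ']
    have hdec : Primrec₂ fun m k : ℕ => decide (2 ^ k = m) :=
      (Primrec.eq (α := ℕ)).decide.comp (hpow.comp Primrec.snd) Primrec.fst
    refine Partrec.bind (Partrec.rfind hdec.to_comp.partrec₂) ?_
    exact (Nat.Partrec.Code.eval_part.comp
      ((Computable.ofNat _).comp Computable.snd) (Computable.const 0)).to₂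
  · have : (Nat.rfind fun j => Part.some (decide (2 ^ j = 2 ^ k))) = Part.some k := by
      refine Part.eq_some_iff.2 (Nat.mem_rfind.2 ⟨by simp, fun {j} hj => ?_⟩)
      simpa using hj.ne
    refine (iff_of_eq (congrArg (fun p : Part ℕ => (p.bind _).Dom) this)).trans ?_
    rw [Part.bind_some]

/-- Binary digits come with the least significant first. Powers of two serve as inputs because the
resulting tapes differ only in how often one letter is repeated. -/
theorem trNat_two_pow (k : ℕ) :
    PartrecToTM2.trNat (2 ^ k) =
      List.replicate k PartrecToTM2.Γ'.bit0 ++ [PartrecToTM2.Γ'.bit1] := by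
  suffices ∃ n : PosNum, ((2 ^ k : ℕ) : Num) = Num.pos n ∧ PartrecToTM2.trPosNum n =
      List.replicate k PartrecToTM2.Γ'.bit0 ++ [PartrecToTM2.Γ'.bit1] by
    obtain ⟨n, h, h'⟩ := this
    rw [PartrecToTM2.trNat, h]
    exact h'
  induction k with
  | zero => exact ⟨1, by rw [pow_zero]; rfl, rfl⟩
  | succ k ih =>
    obtain ⟨n, h, h'⟩ := ih
    refine ⟨n.bit0, ?_, by simp [PartrecToTM2.trPosNum, h', List.replicate_succ]⟩
    rw [pow_succ, Nat.mul_two, Nat.cast_add, h]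
    exact congrArg Num.pos (PosNum.bit0_of_bit0 n)

/-- Halting is undecidable for some finite Turing machine, already on inputs of the form
`x₀ x₁ x₂ x₂ … x₂`. -/
theorem exists_machine_halting_undecidable :
    ∃ (Γ Λ : Type) (_ : Inhabited Γ) (_ : Inhabited Λ) (_ : Finite Γ) (_ : Finite Λ)
      (M : TM0.Machine Γ Λ) (x₀ x₁ x₂ : Γ),
      ¬ ComputablePred fun k : ℕ =>
        (StateTransition.eval (TM0.step M) (TM0.init (x₀ :: x₁ :: List.replicate k x₂))).Dom := by
  classical
  obtain ⟨f, hf, hfd⟩ := exists_partrec_two_pow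
  obtain ⟨c, hc⟩ := ToPartrec.Code.exists_code (Nat.Partrec'.part_iff₁.2 hf)
  -- `TM2.init` starts in the `default` state, which therefore has to be the program of `c`.
  let _ : Inhabited PartrecToTM2.Λ' := ⟨PartrecToTM2.trNormal c PartrecToTM2.Cont'.halt⟩
  have : Finite PartrecToTM2.K' := Finite.of_injective
    (fun k : PartrecToTM2.K' => (PartrecToTM2.K'.rec 0 1 2 3 k : Fin 4))
    (by rintro ⟨⟩ ⟨⟩ h <;> first | rfl | simp at h)
  let Γ := TM2to1.Γ' PartrecToTM2.K' (fun _ => PartrecToTM2.Γ')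
  let M₁ := TM2to1.tr PartrecToTM2.tr
  let M₀ := TM1to0.tr M₁
  -- The translated machine has infinitely many states, but those reachable from the start lie in
  -- the finite set `S`, to which `M` restricts it.
  let S := TM1to0.trStmts M₁ (TM2to1.trSupp PartrecToTM2.tr
    (PartrecToTM2.codeSupp c PartrecToTM2.Cont'.halt))
  have hS : TM0.Supports M₀ (S : Set (TM1to0.Λ' M₁)) :=
    TM1to0.tr_supports _ (TM2to1.tr_supports _ (PartrecToTM2.tr_supports c _))
  let _ : Inhabited S := ⟨⟨default, hS.1⟩⟩
  let g₁ : PointedMap (TM1to0.Λ' M₁) S :=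
    ⟨fun q => if h : q ∈ S then ⟨q, h⟩ else default, dif_pos hS.1⟩
  let g₂ : S → TM1to0.Λ' M₁ := Subtype.val
  have hg : ∀ q ∈ (S : Set (TM1to0.Λ' M₁)), g₂ (g₁ q) = q := fun q hq => by
    show ((if h : q ∈ S then ⟨q, h⟩ else default : S) : TM1to0.Λ' M₁) = q
    rw [dif_pos (Finset.mem_coe.1 hq)]
  let ι : PointedMap Γ Γ := ⟨id, rfl⟩
  let M := M₀.map ι ι g₁ g₂
  -- All stacks but `main` are empty at the start. The Boolean paired with `w a` marks the bottom of
  -- the stacks, hence is `true` at the first cell only.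
  let w (a : PartrecToTM2.Γ') : ∀ _ : PartrecToTM2.K', Option PartrecToTM2.Γ' :=
    Function.update (fun _ => none) PartrecToTM2.K'.main (some a)
  refine ⟨Γ, S, inferInstance, inferInstance, inferInstanceAs (Finite (Bool × _)), inferInstance,
    M, (true, w .cons), (false, w .bit1), (false, w .bit0), fun h => ?_⟩
  refine not_computablePred_dom_decode (h.of_eq fun k => ?_)
  have hinit : TM2to1.trInit PartrecToTM2.K'.main (PartrecToTM2.trList [2 ^ k]) =
      ((true, w .cons) :: (false, w .bit1) :: List.replicate k (false, w .bit0) : List Γ) := by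
    have e : (PartrecToTM2.trList [2 ^ k]).reverse = PartrecToTM2.Γ'.cons ::
        PartrecToTM2.Γ'.bit1 :: List.replicate k PartrecToTM2.Γ'.bit0 := by
      simp [trNat_two_pow]
    have e' := List.map_replicate (n := k) (a := PartrecToTM2.Γ'.bit0)
      (f := fun a => ((false, w a) : Γ))
    refine Eq.trans ?_ (congrArg
      (fun l : List Γ => ((true, w .cons) : Γ) :: ((false, w .bit1) : Γ) :: l) e')
    unfold TM2to1.trInit
    rw [e]
    rfl
  have h₂ : TM2.init PartrecToTM2.K'.main (PartrecToTM2.trList [2 ^ k]) =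
      PartrecToTM2.init c [2 ^ k] := by
    refine congrArg (TM2.Cfg.mk _ _) (funext ?_)
    rintro ⟨⟩ <;> simp
  rw [← hinit]
  have e₁ := StateTransition.tr_eval_dom
    (TM0.Machine.map_respects M₀ ι ι g₁ g₂ hS (fun _ => rfl) hg)
    (a₁ := TM0.init (TM2to1.trInit PartrecToTM2.K'.main (PartrecToTM2.trList [2 ^ k])))
    ⟨hS.1, rfl⟩
  rw [TM0.map_init, show ι.f = id from rfl, List.map_id] at e₁
  refine e₁.trans ?_
  change (TM0.eval M₀ _).Dom ↔ _
  rw [TM1to0.tr_eval]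
  refine (TM2to1.tr_eval_dom PartrecToTM2.tr PartrecToTM2.K'.main _).trans ?_
  change (StateTransition.eval _ (TM2.init _ _)).Dom ↔ _
  rw [h₂, PartrecToTM2.tr_eval, ← hfd k]
  have := hc ⟨[2 ^ k], rfl⟩
  change c.eval [2 ^ k] = pure <$> f (2 ^ k) at this
  rw [this]
  rfl

/-! ### One-sided cellular automata -/

section Words

variable {C : Type*}

/-- The word `w`, shifted one place to the right, with `z` as its first letter. -/
def shiftWord (z : C) (w : ℕ → C) : ℕ → C
  | 0 => z
  | j + 1 => w j

/-- The one-sided cellular automaton on infinite words with local rule `g`, whose cells see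
themselves and the two cells to the left of them; `z` is the letter seen beyond the left end. -/
def oneSided (g : C → C → C → C) (z : C) (w : ℕ → C) : ℕ → C :=
  fun j => g (shiftWord z (shiftWord z w) j) (shiftWord z w j) (w j)

/-- The word `a₀ a₁ a₂ a₂ … a₂ b b …` with `k` letters `a₂`. -/
def inputWord (a₀ a₁ a₂ b : C) (k : ℕ) : ℕ → C
  | 0 => a₀
  | 1 => a₁
  | j + 2 => if j < k then a₂ else b

/-- The one-sided cellular automaton with local rule `g` on bi-infinite words. -/
def oneSidedInt (g : C → C → C → C) (W : ℤ → C) : ℤ → C :=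
  fun j => g (W (j - 2)) (W (j - 1)) (W j)

theorem oneSidedInt_neg {g : C → C → C → C} {z : C} (hz : g z z z = z) {W : ℤ → C}
    (hW : ∀ j < 0, W j = z) : ∀ j < 0, oneSidedInt g W j = z := fun j hj => by
  simp [oneSidedInt, hW j hj, hW (j - 1) (by omega), hW (j - 2) (by omega), hz]

theorem oneSided_restrict {g : C → C → C → C} {z : C} {W : ℤ → C}
    (hW : ∀ j < 0, W j = z) :
    oneSided g z (fun j : ℕ => W j) = fun j : ℕ => oneSidedInt g W j := by
  funext j
  rcases j with - | - | j
  · simp [oneSided, oneSidedInt, shiftWord, hW]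
  · simp [oneSided, oneSidedInt, shiftWord, hW]
  · simp only [oneSided, oneSidedInt, shiftWord]
    congr 2 <;> push_cast <;> ring

/-- As `z` is quiescent, nothing happens left of the origin, and runs on the half-line can be
studied on `ℤ`, without boundary cases. -/
theorem iterate_oneSided_restrict {g : C → C → C → C} {z : C} (hz : g z z z = z) {W : ℤ → C}
    (hW : ∀ j < 0, W j = z) (t : ℕ) :
    (∀ j < 0, (oneSidedInt g)^[t] W j = z) ∧
      (oneSided g z)^[t] (fun j : ℕ => W j) = fun j : ℕ => (oneSidedInt g)^[t] W j := by
  induction t with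
  | zero => exact ⟨hW, rfl⟩
  | succ t ih =>
    simp only [Function.iterate_succ_apply']
    exact ⟨oneSidedInt_neg hz ih.1, by rw [ih.2, oneSided_restrict ih.1]⟩

theorem eq_of_restrict_eq {z : C} {W W' : ℤ → C} (hW : ∀ j < 0, W j = z)
    (hW' : ∀ j < 0, W' j = z) (h : (fun j : ℕ => W j) = fun j : ℕ => W' j) : W = W' := by
  funext j
  rcases lt_or_ge j 0 with hj | hj
  · rw [hW j hj, hW' j hj]
  · lift j to ℕ using hj
    exact congrFun h j

end Words

/-! ### Simulation of Turing machines -/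

/-- Cells of the cellular automaton that simulates a Turing machine: never visited cells, cells
that have halted, and cells with a tape symbol and possibly the machine in some state. -/
inductive Cell (Γ Λ : Type) : Type
  | fresh : Cell Γ Λ
  | halted : Cell Γ Λ
  | inner : Γ → Option Λ → Cell Γ Λ

section Simulation

variable {Γ Λ : Type}

instance [Finite Γ] [Finite Λ] : Finite (Cell Γ Λ) :=
  Finite.of_injective
    (fun c : Cell Γ Λ => match c with
      | .fresh => (none : Option (Option (Γ × Option Λ)))
      | .halted => some none
      | .inner a q => some (some (a, q)))
    (by rintro (_ | _ | _) (_ | _ | _) h <;> simp_all)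

variable [Inhabited Γ]

/-- The word that represents a configuration with the head at place `h`, and with all cells
to the right of place `R` never visited. -/
def configWord (c : TM0.Cfg Γ Λ) (h R : ℤ) : ℤ → Cell Γ Λ := fun j =>
  if j ≤ R then .inner (c.Tape.nth (j - h)) (if j = h then some c.q else none) else .fresh

theorem configWord_ne_halted (c : TM0.Cfg Γ Λ) (h R j : ℤ) : configWord c h R j ≠ .halted := by
  unfold configWord; split_ifs <;> simp

theorem configWord_eq_fresh (c : TM0.Cfg Γ Λ) (h R j : ℤ) :
    configWord c h R j = .fresh ↔ R < j := by
  unfold configWord; split_ifs <;> simp_all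

variable [Inhabited Λ] (M : TM0.Machine Γ Λ)

/-- The state in which the machine leaves a cell in direction `d`. -/
def departure (d : Dir) : Cell Γ Λ → Option Λ
  | .inner a (some q) =>
    match M q a with
    | some (q', .move d') => if d' = d then some q' else none
    | _ => none
  | _ => none

/-- One step of the machine, for a cell with given left and right neighbours. -/
def cellStep (l c r : Cell Γ Λ) : Cell Γ Λ :=
  match c with
  | .halted => .halted
  | .fresh =>
    match (departure M .right l).or (departure M .left r) with
    | some q => .inner default (some q)
    | none => .fresh
  | .inner a none => .inner a ((departure M .right l).or (departure M .left r))
  | .inner a (some q) =>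
    match M q a with
    | none => .halted
    | some (q', .write b) => .inner b (some q')
    | some (_, .move _) => .inner a none

open Classical in
/-- The local rule of the simulation. The tape drifts to the right by one cell in each step, until
it runs into a halted cell. -/
noncomputable def simRule (a b c : Cell Γ Λ) : Cell Γ Λ :=
  if c = .halted then .halted
  else if a = .halted ∨ b = .halted then (if c = .fresh then .fresh else .halted)
  else cellStep M a b c

theorem oneSidedInt_configWord (c : TM0.Cfg Γ Λ) (h R j : ℤ) :
    oneSidedInt (simRule M) (configWord c h R) j =
      cellStep M (configWord c h R (j - 2)) (configWord c h R (j - 1)) (configWord c h R j) := by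
  simp [oneSidedInt, simRule, configWord_ne_halted]

theorem departure_configWord (d : Dir) (c : TM0.Cfg Γ Λ) {h R : ℤ} (hR : h ≤ R) (j : ℤ) :
    departure M d (configWord c h R j) =
      if j = h then departure M d (.inner c.Tape.head (some c.q)) else none := by
  unfold configWord
  by_cases hj : j = h
  · subst hj; simp [hR]
  · split_ifs <;> simp [departure]

/-- Because of the drift the old head cell reappears at `h + 1`, and its right and left neighbours
at `h + 2` and `h`; all other cells are merely shifted. -/
theorem oneSidedInt_configWord_apply (q : Λ) (T : Tape Γ) {h R : ℤ} (hR : h ≤ R) (j : ℤ) :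
    oneSidedInt (simRule M) (configWord ⟨q, T⟩ h R) j =
      if j = h + 1 then
        (match M q T.head with
        | none => .halted
        | some (q', .write b) => .inner b (some q')
        | some (_, .move _) => .inner T.head none)
      else if j ≤ R + 1 then
        .inner (T.nth (j - 1 - h))
          (if j = h + 2 then departure M .right (.inner T.head (some q))
          else if j = h then departure M .left (.inner T.head (some q)) else none)
      else if j = h + 2 then
        (match departure M .right (.inner T.head (some q)) with
        | some q' => .inner default (some q')
        | none => .fresh)
      else .fresh := by
  rw [oneSidedInt_configWord]
  unfold cellStep
  rw [departure_configWord M _ _ hR, departure_configWord M _ _ hR]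
  by_cases h₁ : j = h + 1
  · subst h₁
    simp only [configWord, hR, if_true, add_sub_cancel_right, sub_self, Tape.nth_zero]
  · have h₂ : ¬ j - 1 = h := by omega
    have h₃ : j - 2 = h ↔ j = h + 2 := by omega
    have h₄ : j - 1 ≤ R ↔ j ≤ R + 1 := by omega
    simp only [configWord, h₁, h₂, h₃, h₄, if_false]
    by_cases h₅ : j ≤ R + 1
    · simp only [h₅, if_true]
      by_cases h₆ : j = h + 2
      · have : ¬ h + 2 = h := by omega
        subst h₆; simp [this]
      · simp [h₆]
    · have h₆ : ¬ j = h := by omega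
      simp only [h₅, h₆, if_false, Option.or_none]
      by_cases h₇ : j = h + 2
      · simp [h₇]
      · simp [h₇]

/-- Fresh cells stand for blanks, so a head that enters one finds the default symbol. The inequality
`R < R'` is what later separates the words of a run that does not halt. -/
theorem simulate_step {c c' : TM0.Cfg Γ Λ} {h R : ℤ} (hR : h ≤ R)
    (hb : ∀ j > R, c.Tape.nth (j - h) = default) (hc : TM0.step M c = some c') :
    ∃ h' R', h' ≤ R' ∧ R < R' ∧ (∀ j > R', c'.Tape.nth (j - h') = default) ∧
      oneSidedInt (simRule M) (configWord c h R) = configWord c' h' R' := by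
  obtain ⟨q, T⟩ := c
  obtain ⟨⟨q', s⟩, hs, rfl⟩ := Option.map_eq_some_iff.1 hc
  rcases s with (d | d) | b
  -- A move to the left cancels the drift, a move to the right doubles it, and writing leaves it
  -- alone: the new head places are `h`, `h + 2` and `h + 1`.
  · refine ⟨h, R + 1, by omega, by omega, fun j hj => ?_, funext fun j => ?_⟩
    · have := hb (j - 1) (by omega)
      simp only [Tape.move_left_nth]
      rwa [show j - h - 1 = j - 1 - h by ring]
    · rw [oneSidedInt_configWord_apply M q T hR]
      simp only [departure, hs, configWord, Tape.move_left_nth, reduceCtorEq, if_false, if_true,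
        show j - h - 1 = j - 1 - h by ring]
      split_ifs <;> first | omega | rfl | simp_all
  · refine ⟨h + 2, max (R + 1) (h + 2), by omega, by omega, fun j hj => ?_, funext fun j => ?_⟩
    · have := hb (j - 1) (by omega)
      simp only [Tape.move_right_nth]
      rwa [show j - (h + 2) + 1 = j - 1 - h by ring]
    · rw [oneSidedInt_configWord_apply M q T hR]
      simp only [departure, hs, configWord, Tape.move_right_nth, reduceCtorEq, if_false, if_true,
        show j - (h + 2) + 1 = j - 1 - h by ring, le_max_iff]
      split_ifs <;> first
        | omega
        | rfl
        | exact congrArg (Cell.inner · _) (hb (j - 1) (by omega)).symm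
        | simp_all
  · refine ⟨h + 1, R + 1, by omega, by omega, fun j hj => ?_, funext fun j => ?_⟩
    · have := hb (j - 1) (by omega)
      have h₁ : ¬ j - 1 - h = 0 := by omega
      simp only [Tape.write_nth]
      rwa [show j - (h + 1) = j - 1 - h by ring, if_neg h₁]
    · rw [oneSidedInt_configWord_apply M q T hR]
      simp only [departure, hs, configWord, Tape.write_nth,
        show j - (h + 1) = j - 1 - h by ring]
      split_ifs <;> first | omega | rfl

theorem simulate_halt {c : TM0.Cfg Γ Λ} {h R : ℤ} (hR : h ≤ R)
    (hc : TM0.step M c = none) :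
    oneSidedInt (simRule M) (configWord c h R) = fun j =>
      if j ≤ R + 1 then (if j = h + 1 then .halted else .inner (c.Tape.nth (j - 1 - h)) none)
      else .fresh := by
  obtain ⟨q, T⟩ := c
  have hs : M q T.head = none := Option.map_eq_none_iff.1 hc
  funext j
  rw [oneSidedInt_configWord_apply M q T hR]
  simp only [departure, hs]
  split_ifs <;> first | omega | rfl

/-! ### Behaviour after halting -/

/-- A word with halted cells at the places from `p` to `q`, which run into the inner cells up
to place `b`. -/
def haltedWord (Λ : Type) (u : ℤ → Γ) (p q b : ℤ) : ℤ → Cell Γ Λ := fun j =>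
  if p ≤ j ∧ j ≤ q then .halted else if j ≤ b then .inner (u j) none else .fresh

/-- The wall grows by two cells per step and the fresh border recedes by one, so the wall catches up
and both stop. Its left end stays at `p`, since halted cells affect only cells to their right. -/
theorem oneSidedInt_haltedWord (u : ℤ → Γ) {p q b : ℤ} (hpq : p ≤ q) (hqb : q ≤ b) :
    oneSidedInt (simRule M) (haltedWord Λ u p q b) =
      haltedWord Λ (fun j => u (j - 1)) p (if q + 2 ≤ b then q + 2 else b)
        (if q + 2 ≤ b then b + 1 else b) := by
  funext j
  have key : ∀ j, haltedWord Λ u p q b j = .halted ↔ p ≤ j ∧ j ≤ q := fun j => by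
    unfold haltedWord; split_ifs <;> simp_all
  have key₂ : ∀ j, haltedWord Λ u p q b j = .fresh ↔ b < j := fun j => by
    unfold haltedWord; split_ifs <;> simp_all; omega
  have dep : ∀ d j, departure M d (haltedWord Λ u p q b j) = none := fun d j => by
    unfold haltedWord; split_ifs <;> rfl
  have step : ∀ j, ¬ (p ≤ j - 1 ∧ j - 1 ≤ q) → cellStep M (haltedWord Λ u p q b (j - 2))
      (haltedWord Λ u p q b (j - 1)) (haltedWord Λ u p q b j) =
        if j - 1 ≤ b then .inner (u (j - 1)) none else .fresh := fun j hj => by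
    unfold cellStep
    simp only [dep]
    simp only [haltedWord, hj, if_false]
    split_ifs <;> rfl
  simp only [oneSidedInt, simRule, key, key₂]
  by_cases h₁ : p ≤ j ∧ j ≤ q
  · rw [if_pos h₁, haltedWord, if_pos (by split_ifs <;> omega)]
  · rw [if_neg h₁]
    by_cases h₂ : (p ≤ j - 2 ∧ j - 2 ≤ q) ∨ (p ≤ j - 1 ∧ j - 1 ≤ q)
    · rw [if_pos h₂]
      unfold haltedWord
      split_ifs <;> first | rfl | omega
    · rw [if_neg h₂, step j (by omega)]
      unfold haltedWord
      split_ifs <;> first | rfl | omega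

theorem iterate_haltedWord_gap (g : ℕ) : ∀ (u : ℤ → Γ) {p q b : ℤ}, p ≤ q → q ≤ b →
    b ≤ q + g → ∃ (t : ℕ) (u' : ℤ → Γ) (b' : ℤ), p ≤ b' ∧
      (oneSidedInt (simRule M))^[t] (haltedWord Λ u p q b) = haltedWord Λ u' p b' b' ∧
      ((∀ j < 0, u j = default) → ∀ j < 0, u' j = default) := by
  induction g with
  | zero =>
    intro u p q b hpq hqb hb
    obtain rfl : q = b := by push_cast at hb; omega
    exact ⟨0, u, q, hpq, rfl, id⟩
  | succ g ih =>
    intro u p q b hpq hqb hb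
    push_cast at hb
    obtain ⟨t, u', b', hb', h, hu⟩ := ih (fun j => u (j - 1)) (p := p)
      (q := if q + 2 ≤ b then q + 2 else b) (b := if q + 2 ≤ b then b + 1 else b)
      (by split_ifs <;> omega) (by split_ifs <;> omega) (by split_ifs <;> omega)
    refine ⟨t + 1, u', b', hb', ?_, fun hj => hu fun j hj' => hj _ (by omega)⟩
    rw [Function.iterate_succ_apply, oneSidedInt_haltedWord M u hpq hqb, h]

theorem iterate_haltedWord (u : ℤ → Γ) {p b : ℤ} (hpb : p ≤ b) (t : ℕ) :
    (oneSidedInt (simRule M))^[t] (haltedWord Λ u p b b) =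
      haltedWord Λ (fun j => u (j - t)) p b b := by
  induction t with
  | zero => simp
  | succ t ih =>
    rw [Function.iterate_succ_apply', ih, oneSidedInt_haltedWord M _ hpb le_rfl]
    have : ¬ b + 2 ≤ b := by omega
    simp only [this, if_false]
    congr 1
    funext j
    congr 1
    push_cast
    ring

theorem haltedWord_eventually_fixed (u : ℤ → Γ) {p q b : ℤ} (hpq : p ≤ q) (hqb : q ≤ b)
    (hu : ∀ j < 0, u j = default) :
    ∃ t, (oneSidedInt (simRule M))^[t + 1] (haltedWord Λ u p q b) =
      (oneSidedInt (simRule M))^[t] (haltedWord Λ u p q b) := by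
  obtain ⟨t, u', b', hb', h, hu'⟩ := iterate_haltedWord_gap M (b - q).toNat u hpq hqb (by omega)
  -- After `t` steps the wall has reached the fresh cells. After `p.toNat` more, every cell left of
  -- `p` holds a symbol that came from a negative place, hence a blank.
  refine ⟨p.toNat + t, ?_⟩
  rw [add_right_comm, Function.iterate_add_apply _ _ t, Function.iterate_add_apply _ _ t, h,
    iterate_haltedWord M u' hb', iterate_haltedWord M u' hb']
  funext j
  unfold haltedWord
  split_ifs with h₁ h₂
  · rfl
  · exact congrArg (Cell.inner · _)
      ((hu' hu _ (by push_cast; omega)).trans (hu' hu _ (by omega)).symm)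
  · rfl

theorem simRule_default :
    simRule M (.inner default none) (.inner default none) (.inner default none) =
      .inner default none := by
  simp [simRule, cellStep, departure]

theorem configWord_eventually_fixed {c : TM0.Cfg Γ Λ} {h R : ℤ} (hR : h ≤ R)
    (hneg : ∀ j < 0, configWord c h R j = .inner default none) (hc : TM0.step M c = none) :
    ∃ t, (oneSidedInt (simRule M))^[t + 1] (configWord c h R) =
      (oneSidedInt (simRule M))^[t] (configWord c h R) := by
  have e : oneSidedInt (simRule M) (configWord c h R) =
      haltedWord Λ (fun j => c.Tape.nth (j - 1 - h)) (h + 1) (h + 1) (R + 1) := by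
    rw [simulate_halt M hR hc]
    funext j
    unfold haltedWord
    split_ifs <;> first | rfl | omega
  have hneg' := oneSidedInt_neg (simRule_default M) hneg
  obtain ⟨t, ht⟩ := haltedWord_eventually_fixed (Λ := Λ) M
    (fun j => c.Tape.nth (j - 1 - h)) (le_refl (h + 1)) (by omega : h + 1 ≤ R + 1) fun j hj => by
      have := hneg' j hj
      rw [e, haltedWord] at this
      split_ifs at this
      simpa using this
  exact ⟨t + 1, by simpa only [Function.iterate_succ_apply, e] using ht⟩

theorem configWord_eventually_fixed_of_halts {c c' : TM0.Cfg Γ Λ}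
    (hcc' : StateTransition.Reaches (TM0.step M) c c') (hc' : TM0.step M c' = none) :
    ∀ {h R : ℤ}, h ≤ R → (∀ j > R, c.Tape.nth (j - h) = default) →
      (∀ j < 0, configWord c h R j = .inner default none) →
      ∃ t, (oneSidedInt (simRule M))^[t + 1] (configWord c h R) =
        (oneSidedInt (simRule M))^[t] (configWord c h R) := by
  induction hcc' using Relation.ReflTransGen.head_induction_on with
  | refl => exact fun hR _ hneg => configWord_eventually_fixed M hR hneg hc'
  | head hcd _ ih =>
    intro h R hR hb hneg
    obtain ⟨h', R', hR', -, hb', e⟩ := simulate_step M hR hb hcd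
    obtain ⟨t, ht⟩ := ih hR' hb' (e ▸ oneSidedInt_neg (simRule_default M) hneg)
    exact ⟨t + 1, by simpa only [Function.iterate_succ_apply, e] using ht⟩

/-- The border `R` can be read off the word, and it strictly increases as long as the machine runs.
-/
theorem configWord_injective_of_not_halts {c : TM0.Cfg Γ Λ}
    (hc : ¬ (StateTransition.eval (TM0.step M) c).Dom) {h R : ℤ} (hR : h ≤ R)
    (hb : ∀ j > R, c.Tape.nth (j - h) = default) :
    Function.Injective fun t => (oneSidedInt (simRule M))^[t] (configWord c h R) := by
  have key : ∀ t : ℕ, ∃ (c' : TM0.Cfg Γ Λ) (h' R' : ℤ),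
      StateTransition.Reaches (TM0.step M) c c' ∧ h' ≤ R' ∧
      (∀ j > R', c'.Tape.nth (j - h') = default) ∧
      (oneSidedInt (simRule M))^[t] (configWord c h R) = configWord c' h' R' := by
    intro t
    induction t with
    | zero => exact ⟨c, h, R, .refl, hR, hb, rfl⟩
    | succ t ih =>
      obtain ⟨c', h', R', hcc', hR', hb', e⟩ := ih
      rcases hs : TM0.step M c' with - | c''
      · exact absurd (Part.dom_iff_mem.2 ⟨c', StateTransition.mem_eval.2 ⟨hcc', hs⟩⟩) hc
      · obtain ⟨h'', R'', hR'', -, hb'', e'⟩ := simulate_step M hR' hb' hs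
        exact ⟨c'', h'', R'', hcc'.tail hs, hR'', hb'', by
          rw [Function.iterate_succ_apply', e, e']⟩
  choose c' h' R' hcc' hR' hb' e using key
  have mono : StrictMono R' := strictMono_nat_of_lt_succ fun t => by
    rcases hs : TM0.step M (c' t) with - | c''
    · exact absurd (Part.dom_iff_mem.2 ⟨c' t, StateTransition.mem_eval.2 ⟨hcc' t, hs⟩⟩) hc
    · obtain ⟨h'', R'', -, hlt, -, e'⟩ := simulate_step M (hR' t) (hb' t) hs
      have e'' := e (t + 1)
      rw [Function.iterate_succ_apply', e t, e'] at e''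
      have h₁ : ∀ j, R'' < j ↔ R' (t + 1) < j := fun j => by
        rw [← configWord_eq_fresh c'' h'' R'' j, e'', configWord_eq_fresh]
      have h₂ := (h₁ (R' (t + 1) + 1)).2 (by omega)
      omega
  intro s t hst
  simp only [e] at hst
  refine mono.injective ?_
  have h₁ : ∀ j, R' s < j ↔ R' t < j := fun j => by
    rw [← configWord_eq_fresh (c' s) (h' s) (R' s) j, hst, configWord_eq_fresh]
  have h₂ := (h₁ (R' t + 1)).2 (by omega)
  have h₃ := (h₁ (R' s + 1)).1 (by omega)
  omega

/-- The cell at `R + 1` is fresh before the step but not after it. This will put the initial point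
outside the limit cycle. -/
theorem oneSidedInt_configWord_ne (c : TM0.Cfg Γ Λ) {h R : ℤ} (hR : h ≤ R)
    (hb : ∀ j > R, c.Tape.nth (j - h) = default) :
    oneSidedInt (simRule M) (configWord c h R) ≠ configWord c h R := fun e => by
  have h₁ := congrFun e (R + 1)
  rw [(configWord_eq_fresh c h R (R + 1)).2 (by omega)] at h₁
  rcases hs : TM0.step M c with - | c'
  · rw [simulate_halt M hR hs] at h₁
    simp only [le_refl, if_true] at h₁
    split_ifs at h₁
  · obtain ⟨h', R', -, hlt, -, e'⟩ := simulate_step M hR hb hs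
    rw [e', configWord_eq_fresh] at h₁
    omega

theorem configWord_init (x₀ x₁ x₂ : Γ) (k : ℕ) :
    (∀ j > (k + 1 : ℤ), (TM0.init (x₀ :: x₁ :: List.replicate k x₂) :
      TM0.Cfg Γ Λ).Tape.nth (j - 0) = default) ∧
    (∀ j < 0, configWord (TM0.init (x₀ :: x₁ :: List.replicate k x₂) : TM0.Cfg Γ Λ) 0 (k + 1) j =
      .inner default none) ∧
    (fun j : ℕ => configWord (TM0.init (x₀ :: x₁ :: List.replicate k x₂) : TM0.Cfg Γ Λ)
      0 (k + 1) j) = inputWord (.inner x₀ (some default)) (.inner x₁ none) (.inner x₂ none)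
        .fresh k := by
  have hnat : ∀ j : ℕ, (TM0.init (x₀ :: x₁ :: List.replicate k x₂) :
      TM0.Cfg Γ Λ).Tape.nth j = (x₀ :: x₁ :: List.replicate k x₂).getI j := fun j => by
    simp [TM0.init, Tape.mk₁, Tape.mk₂]
  refine ⟨fun j hj => ?_, fun j hj => ?_, funext fun j => ?_⟩
  · lift j to ℕ using by omega
    rw [sub_zero, hnat, List.getI_eq_default]
    simp only [List.length_cons, List.length_replicate]
    omega
  · obtain ⟨n, rfl⟩ := Int.eq_negSucc_of_lt_zero hj
    have h₁ : Int.negSucc n ≤ k + 1 := by omega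
    have h₂ : Int.negSucc n ≠ 0 := by omega
    simp only [configWord, h₁, h₂, if_true, if_false, sub_zero]
    congr 1
  · simp only [configWord, sub_zero, hnat]
    rcases j with - | - | j
    · simp [inputWord, TM0.init]
      omega
    · simp [inputWord]
    · have h₁ : ((j + 1 + 1 : ℕ) : ℤ) ≤ k + 1 ↔ j < k := by omega
      have h₂ : ((j + 1 + 1 : ℕ) : ℤ) ≠ 0 := by omega
      simp only [inputWord, h₁, h₂, if_false]
      split_ifs with h
      · simp [List.getI_eq_getElem?_getD, h]
      · rfl

end Simulation

/-! ### Renaming the letters -/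

section Transport

variable {C D : Type*} {e : C → D}

theorem comp_inputWord (a₀ a₁ a₂ b : C) (k : ℕ) :
    e ∘ inputWord a₀ a₁ a₂ b k = inputWord (e a₀) (e a₁) (e a₂) (e b) k := by
  funext j
  rcases j with - | - | j
  · rfl
  · rfl
  · simp only [Function.comp_apply, inputWord]
    split_ifs <;> rfl

theorem comp_shiftWord (z : C) (w : ℕ → C) :
    e ∘ shiftWord z w = shiftWord (e z) (e ∘ w) := by
  funext j
  cases j <;> rfl

theorem semiconj_oneSided {g : C → C → C → C} {g' : D → D → D → D}
    (h : ∀ a b c, e (g a b c) = g' (e a) (e b) (e c)) (z : C) :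
    Function.Semiconj (e ∘ ·) (oneSided g z) (oneSided g' (e z)) := fun w => by
  funext j
  simp only [oneSided, ← comp_shiftWord, h, Function.comp_apply]

end Transport

/-- There is a one-sided cellular automaton for which it is undecidable whether its orbits
are eventually constant, already for orbits of the words `a₀ a₁ a₂ a₂ … a₂ b b …`; moreover
no word of this form is a fixed point, and orbits that are not eventually constant do not
meet any word twice. -/
theorem exists_oneSided_undecidable :
    ∃ (n : ℕ) (g : Fin n → Fin n → Fin n → Fin n) (z a₀ a₁ a₂ b : Fin n),
      (¬ ComputablePred fun k : ℕ => ∃ t, (oneSided g z)^[t + 1] (inputWord a₀ a₁ a₂ b k) =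
        (oneSided g z)^[t] (inputWord a₀ a₁ a₂ b k)) ∧
      ∀ k, oneSided g z (inputWord a₀ a₁ a₂ b k) ≠ inputWord a₀ a₁ a₂ b k ∧
        ((∃ t, (oneSided g z)^[t + 1] (inputWord a₀ a₁ a₂ b k) =
            (oneSided g z)^[t] (inputWord a₀ a₁ a₂ b k)) ∨
          Function.Injective fun t => (oneSided g z)^[t] (inputWord a₀ a₁ a₂ b k)) := by
  obtain ⟨Γ, Λ, _, _, _, _, M, x₀, x₁, x₂, hM⟩ := exists_machine_halting_undecidable
  obtain ⟨n, ⟨e⟩⟩ := Finite.exists_equiv_fin (Cell Γ Λ)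
  let g : Fin n → Fin n → Fin n → Fin n := fun a b c =>
    e (simRule M (e.symm a) (e.symm b) (e.symm c))
  let z : Cell Γ Λ := .inner default none
  let a₀ : Cell Γ Λ := .inner x₀ (some default)
  let a₁ : Cell Γ Λ := .inner x₁ none
  let a₂ : Cell Γ Λ := .inner x₂ none
  let W (k : ℕ) : ℤ → Cell Γ Λ :=
    configWord (TM0.init (x₀ :: x₁ :: List.replicate k x₂)) 0 (k + 1)
  have iter (k t : ℕ) : (oneSided g (e z))^[t] (inputWord (e a₀) (e a₁) (e a₂) (e .fresh) k) =
      fun j : ℕ => e ((oneSidedInt (simRule M))^[t] (W k) j) := by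
    rw [← comp_inputWord, ← (configWord_init x₀ x₁ x₂ k).2.2]
    have := (semiconj_oneSided (e := e) (g := simRule M) (g' := g) (by simp [g]) z).iterate_right t
    refine (this _).symm.trans ?_
    rw [(iterate_oneSided_restrict (simRule_default M) (configWord_init x₀ x₁ x₂ k).2.1 t).2]
    rfl
  have iter_inj (k s t : ℕ) : (oneSided g (e z))^[s]
        (inputWord (e a₀) (e a₁) (e a₂) (e .fresh) k) =
      (oneSided g (e z))^[t] (inputWord (e a₀) (e a₁) (e a₂) (e .fresh) k) ↔
      (oneSidedInt (simRule M))^[s] (W k) = (oneSidedInt (simRule M))^[t] (W k) := by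
    have neg := iterate_oneSided_restrict (simRule_default M) (configWord_init x₀ x₁ x₂ k).2.1
    rw [iter, iter]
    refine ⟨fun h => eq_of_restrict_eq (neg s).1 (neg t).1 (funext fun j => ?_), fun h => by rw [h]⟩
    exact e.injective (congrFun h j)
  have inj (k : ℕ) (h : ¬ (StateTransition.eval (TM0.step M)
      (TM0.init (x₀ :: x₁ :: List.replicate k x₂))).Dom) :
      Function.Injective fun t => (oneSidedInt (simRule M))^[t] (W k) :=
    configWord_injective_of_not_halts M h (by omega) (configWord_init x₀ x₁ x₂ k).1
  have fixed (k : ℕ) (h : (StateTransition.eval (TM0.step M)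
      (TM0.init (x₀ :: x₁ :: List.replicate k x₂))).Dom) :
      ∃ t, (oneSidedInt (simRule M))^[t + 1] (W k) = (oneSidedInt (simRule M))^[t] (W k) := by
    obtain ⟨c, hc⟩ := Part.dom_iff_mem.1 h
    obtain ⟨hc, hc'⟩ := StateTransition.mem_eval.1 hc
    exact configWord_eventually_fixed_of_halts M hc hc' (by omega) (configWord_init x₀ x₁ x₂ k).1
      (configWord_init x₀ x₁ x₂ k).2.1
  refine ⟨n, g, e z, e a₀, e a₁, e a₂, e .fresh, fun h => hM (h.of_eq fun k => ?_), fun k => ?_⟩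
  · simp only [iter_inj]
    refine ⟨fun ⟨t, ht⟩ => ?_, fixed k⟩
    by_contra h'
    have := inj k h' ht
    omega
  · simp only [iter_inj]
    refine ⟨fun h => ?_, ?_⟩
    · exact oneSidedInt_configWord_ne M _ (by omega) (configWord_init x₀ x₁ x₂ k).1
        ((iter_inj k 1 0).1 h)
    · by_cases h : (StateTransition.eval (TM0.step M)
        (TM0.init (x₀ :: x₁ :: List.replicate k x₂))).Dom
      · exact .inl (fixed k h)
      · exact .inr fun s t hst => inj k h ((iter_inj k s t).1 hst)

/-! ### Bisimulations -/

section Bisimulation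

variable {I Φ : Type}

/-- Bisimilarity of pointed Kripke models. -/
def Bisimilar (x y : PointedModel I Φ) : Prop :=
  ∃ Z : x.State → y.State → Prop, Z x.point y.point ∧ ∀ s t, Z s t →
    (∀ p, x.V p s ↔ y.V p t) ∧
    (∀ i s', x.R i s s' → ∃ t', y.R i t t' ∧ Z s' t') ∧
    (∀ i t', y.R i t t' → ∃ s', x.R i s s' ∧ Z s' t')

theorem satAt_iff_of_bisimulation {x y : PointedModel I Φ} {Z : x.State → y.State → Prop}
    (hZ : ∀ s t, Z s t →
      (∀ p, x.V p s ↔ y.V p t) ∧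
      (∀ i s', x.R i s s' → ∃ t', y.R i t t' ∧ Z s' t') ∧
      (∀ i t', y.R i t t' → ∃ s', x.R i s s' ∧ Z s' t'))
    (φ : Formula I Φ) : ∀ {s t}, Z s t → (x.SatAt s φ ↔ y.SatAt t φ) := by
  induction φ with
  | top => exact fun _ => Iff.rfl
  | atom p => exact fun h => (hZ _ _ h).1 p
  | neg φ ih => exact fun h => not_congr (ih h)
  | and φ ψ ih₁ ih₂ => exact fun h => and_congr (ih₁ h) (ih₂ h)
  | box i φ ih =>
    refine fun {s t} h => ⟨fun hs t' ht' => ?_, fun ht s' hs' => ?_⟩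
    · obtain ⟨s', hs', hst⟩ := (hZ s t h).2.2 i t' ht'
      exact (ih hst).1 (hs s' hs')
    · obtain ⟨t', ht', hst⟩ := (hZ s t h).2.1 i s' hs'
      exact (ih hst).2 (ht t' ht')

theorem Bisimilar.sat_iff {x y : PointedModel I Φ} (h : Bisimilar x y) (φ : Formula I Φ) :
    x.Sat φ ↔ y.Sat φ :=
  let ⟨_, h₀, hZ⟩ := h
  satAt_iff_of_bisimulation hZ φ h₀

theorem ActionModel.update_eq_product (A : ActionModel I Φ) {x : PointedModel I Φ} {σ : A.Action}
    (hσ : σ ∈ A.designated) (h : x.Sat (A.pre σ))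
    (hu : ∀ τ ∈ A.designated, x.Sat (A.pre τ) → τ = σ) : A.update x = A.product x σ h := by
  have hex : ∃ σ, σ ∈ A.designated ∧ x.Sat (A.pre σ) := ⟨σ, hσ, h⟩
  have aux : ∀ τ (hτ : x.Sat (A.pre τ)), τ = σ → A.product x τ hτ = A.product x σ h := by
    rintro τ hτ rfl
    rfl
  rw [ActionModel.update, dif_pos hex]
  exact aux _ _ (hu _ hex.choose_spec.1 hex.choose_spec.2)

end Bisimulation

/-! ### Dynamics -/

section Dynamics

variable {I Φ : Type}

theorem ModalSpace.isOpen_sat {X : Set (PointedModel I Φ)} (φ : Formula I Φ) :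
    IsOpen {x : ModalSpace X | x.Sat φ} :=
  TopologicalSpace.isOpen_generateFrom_of_mem ⟨φ, rfl⟩

theorem ModalSpace.mk_eq_mk {X : Set (PointedModel I Φ)} {x y : PointedModel I Φ} (hx : x ∈ X)
    (hy : y ∈ X) : mk x hx = mk y hy ↔ ∀ φ : Formula I Φ, x.Sat φ ↔ y.Sat φ :=
  ⟨fun h => Quotient.exact (s := modalSetoid X) h,
    fun h => Quotient.sound (s := modalSetoid X) h⟩

theorem ModalSpace.ext {X : Set (PointedModel I Φ)} {x y : ModalSpace X}
    (h : ∀ φ, x.Sat φ ↔ y.Sat φ) : x = y := by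
  induction x using Quotient.inductionOn with
  | h x =>
    induction y using Quotient.inductionOn with
    | h y => exact Quotient.sound (s := modalSetoid X) h

/-- Negation makes the generating sets clopen, and they separate points. Uniqueness of limits is
needed to compute limit sets. -/
instance (X : Set (PointedModel I Φ)) : T2Space (ModalSpace X) := by
  refine ⟨fun x y hxy => ?_⟩
  have h : ∃ φ : Formula I Φ, x.Sat φ ∧ ¬ y.Sat φ := by
    by_contra! h
    refine hxy (ModalSpace.ext fun φ => ⟨h φ, fun hy => ?_⟩)
    by_contra hx
    induction x using Quotient.inductionOn with
    | h x =>
      induction y using Quotient.inductionOn with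
      | h y => exact h (.neg φ) hx hy
  obtain ⟨φ, hx, hy⟩ := h
  refine ⟨{x | x.Sat φ}, {x | x.Sat (.neg φ)}, ModalSpace.isOpen_sat φ,
    ModalSpace.isOpen_sat _, hx, ?_, Set.disjoint_left.2 fun z hz hz' => ?_⟩
  · induction y using Quotient.inductionOn with
    | h y => exact hy
  · induction z using Quotient.inductionOn with
    | h z => exact hz' hz

variable {α : Type*} {f : α → α} {u : ℕ → α}

theorem iterate_apply_of_step (hf : ∀ t, f (u t) = u (t + 1)) (n t : ℕ) :
    f^[n] (u t) = u (t + n) := by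
  induction n with
  | zero => rfl
  | succ n ih => rw [Function.iterate_succ_apply', ih, hf, add_assoc]

theorem not_hasPeriodicOrbit (hu : ∀ x, ∃ t, u t = x) (hf : ∀ t, f (u t) = u (t + 1))
    (hinj : Function.Injective u) : ¬ HasPeriodicOrbit f := by
  rintro ⟨x, n, k, hk, h⟩
  obtain ⟨t, rfl⟩ := hu x
  rw [iterate_apply_of_step hf, iterate_apply_of_step hf] at h
  have := hinj h
  omega

theorem not_hasLimitCycle [TopologicalSpace α] (hu : ∀ x, ∃ t, u t = x)
    (hf : ∀ t, f (u t) = u (t + 1)) (hinj : Function.Injective u) : ¬ HasLimitCycle f :=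
  fun ⟨x, hx, _⟩ => not_hasPeriodicOrbit hu hf hinj ⟨x, hx⟩

theorem hasPeriodicOrbit_of_fixed (hf : ∀ t, f (u t) = u (t + 1)) {t : ℕ}
    (ht : u (t + 1) = u t) : HasPeriodicOrbit f :=
  ⟨u t, 0, 1, one_pos, (hf t).trans ht⟩

/-- From `t` on the orbit of `u 0` is constant, so its only limit is `u t`. If `u 0` were equal to
`u t` it would be fixed, against `h₀`. -/
theorem hasLimitCycle_of_fixed [TopologicalSpace α] [T2Space α] (hf : ∀ t, f (u t) = u (t + 1))
    {t : ℕ} (ht : u (t + 1) = u t) (h₀ : u 1 ≠ u 0) : HasLimitCycle f := by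
  have hfix : ∀ n, f^[n] (u t) = u t := fun n => Function.iterate_fixed ((hf t).trans ht) n
  have horb : orbit f (u t) = {u t} := by
    simp only [orbit, hfix, Set.range_const]
  have hev : ∀ n ≥ t, f^[n] (u 0) = u t := fun n hn => by
    obtain ⟨j, rfl⟩ := Nat.exists_eq_add_of_le hn
    rw [iterate_apply_of_step hf, Nat.zero_add, ← iterate_apply_of_step hf, hfix]
  refine ⟨u t, ⟨0, 1, one_pos, (hf t).trans ht⟩, u 0, ?_, ?_⟩
  · rw [horb, Set.mem_singleton_iff]
    intro h
    refine h₀ ?_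
    rw [← Nat.zero_add 1, ← hf 0, h, hf, ht]
  · rw [horb]
    refine (Set.eq_singleton_iff_unique_mem.2 ⟨?_, ?_⟩).symm
    · refine ⟨id, strictMono_id, ?_⟩
      exact tendsto_const_nhds.congr' (eventually_atTop.2 ⟨t, fun n hn => (hev n hn).symm⟩)
    · rintro y ⟨n, hn, hy⟩
      refine tendsto_nhds_unique hy (tendsto_const_nhds.congr'
        (eventually_atTop.2 ⟨t, fun j hj => (hev _ (hj.trans (hn.le_apply))).symm⟩))

end Dynamics

/-! ### Clean maps that simulate a given map -/

section Representation

variable {k m : ℕ} {W : Type*} {model : W → PointedModel (Fin k) (Fin m)}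
  {A : FinActionModel k m} {F : W → W}

theorem bisimilar_iterate_update
    (hA : ∀ x w, Bisimilar x (model w) →
      Bisimilar (A.toActionModel.update x) (model (F w)))
    {x : PointedModel (Fin k) (Fin m)} {w : W} (hx : Bisimilar x (model w)) (t : ℕ) :
    Bisimilar (A.toActionModel.update^[t] x) (model (F^[t] w)) := by
  induction t with
  | zero => exact hx
  | succ t ih =>
    rw [Function.iterate_succ_apply', Function.iterate_succ_apply']
    exact hA _ _ ih

theorem sat_iff_iff_of_bisimilar
    (hsep : ∀ w w', (∀ φ, (model w).Sat φ ↔ (model w').Sat φ) → w = w')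
    {x y : PointedModel (Fin k) (Fin m)} {w w' : W} (hx : Bisimilar x (model w))
    (hy : Bisimilar y (model w')) : (∀ φ, x.Sat φ ↔ y.Sat φ) ↔ w = w' := by
  refine ⟨fun h => hsep w w' fun φ => ?_, fun h φ => ?_⟩
  · rw [← hx.sat_iff, h, hy.sat_iff]
  · rw [hx.sat_iff, hy.sat_iff, h]

/-- The map is well defined because, by `hsep`, modally equivalent models in the space represent the
same `w`, so that their updates represent the same `F w`. Preconditions are finitely many since
actions are. -/
theorem exists_cleanMap (Λ : Set (Formula (Fin k) (Fin m)))
    (hsep : ∀ w w', (∀ φ, (model w).Sat φ ↔ (model w').Sat φ) → w = w')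
    (hdes : ∀ x w, Bisimilar x (model w) →
      ∃! σ, σ ∈ A.toActionModel.designated ∧ x.Sat (A.toActionModel.pre σ))
    (hA : ∀ x w, Bisimilar x (model w) →
      Bisimilar (A.toActionModel.update x) (model (F w)))
    {M : FinModel k m} {w : W} (hM : Bisimilar M.toPointedModel (model w)) :
    ∃ f, IsCleanMapBasedOn Λ A.toActionModel (Presentation.models ⟨A, M⟩) f := by
  have hX : ∀ x ∈ Presentation.models ⟨A, M⟩, ∃ w', Bisimilar x (model w') := by
    rintro _ ⟨t, rfl⟩
    exact ⟨_, bisimilar_iterate_update hA hM t⟩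
  have hclosing : A.toActionModel.ClosingOver (Presentation.models ⟨A, M⟩) := by
    rintro _ ⟨t, rfl⟩
    exact ⟨t + 1, Function.iterate_succ_apply' _ _ _⟩
  refine ⟨fun x => Quotient.lift (s := modalSetoid _)
    (fun y => ModalSpace.mk (A.toActionModel.update y.1) (hclosing y.1 y.2))
    (fun y y' h => ?_) x, ?_, fun x hx => ?_, fun σ hσ σ' hσ' hne x hx h => ?_, hclosing,
    fun _ _ => rfl⟩
  · obtain ⟨w₁, h₁⟩ := hX y.1 y.2
    obtain ⟨w₂, h₂⟩ := hX y'.1 y'.2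
    rw [ModalSpace.mk_eq_mk, sat_iff_iff_of_bisimilar hsep (hA _ _ h₁) (hA _ _ h₂),
      (sat_iff_iff_of_bisimilar hsep h₁ h₂).1 h]
  · exact Set.finite_range (ι := Fin (A.last + 1)) fun σ => proposition Λ (A.pre σ)
  · obtain ⟨w', h'⟩ := hX x hx
    exact (hdes x w' h').exists
  · obtain ⟨w', h'⟩ := hX x hx
    exact hne ((hdes x w' h').unique ⟨hσ, h.1⟩ ⟨hσ', h.2⟩)

/-- All points of the space lie on the sequence `u`, whose coincidences are exactly those of the
iterates of `F` at `w`, by `hsep` and bisimulation invariance. -/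
theorem cleanMap_dichotomy {Λ : Set (Formula (Fin k) (Fin m))}
    (hsep : ∀ w w', (∀ φ, (model w).Sat φ ↔ (model w').Sat φ) → w = w')
    (hA : ∀ x w, Bisimilar x (model w) →
      Bisimilar (A.toActionModel.update x) (model (F w)))
    {M : FinModel k m} {w : W} (hM : Bisimilar M.toPointedModel (model w))
    (hw : F w ≠ w) (hw' : (∃ t, F^[t + 1] w = F^[t] w) ∨ Function.Injective fun t => F^[t] w)
    {f : ModalSpace (Presentation.models ⟨A, M⟩) → ModalSpace (Presentation.models ⟨A, M⟩)}
    (hf : IsCleanMapBasedOn Λ A.toActionModel (Presentation.models ⟨A, M⟩) f) :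
    (HasPeriodicOrbit f ↔ ∃ t, F^[t + 1] w = F^[t] w) ∧
      (HasLimitCycle f ↔ ∃ t, F^[t + 1] w = F^[t] w) := by
  let u : ℕ → ModalSpace (Presentation.models ⟨A, M⟩) := fun t =>
    ModalSpace.mk (A.toActionModel.update^[t] M.toPointedModel) ⟨t, rfl⟩
  have hu : ∀ x, ∃ t, u t = x := fun x => by
    induction x using Quotient.inductionOn with
    | h x =>
      obtain ⟨_, t, rfl⟩ := x
      exact ⟨t, rfl⟩
  have hstep : ∀ t, f (u t) = u (t + 1) := fun t => by
    refine (hf.map_eq _ _).trans ((ModalSpace.mk_eq_mk _ _).2 ?_)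
    rw [Function.iterate_succ_apply']
    exact fun _ => Iff.rfl
  have heq : ∀ s t, u s = u t ↔ F^[s] w = F^[t] w := fun s t => by
    refine (ModalSpace.mk_eq_mk _ _).trans ?_
    exact sat_iff_iff_of_bisimilar hsep (bisimilar_iterate_update hA hM s)
      (bisimilar_iterate_update hA hM t)
  by_cases h : ∃ t, F^[t + 1] w = F^[t] w
  · obtain ⟨t, ht⟩ := h
    have ht' := (heq _ _).2 ht
    exact ⟨iff_of_true (hasPeriodicOrbit_of_fixed hstep ht') ⟨t, ht⟩,
      iff_of_true (hasLimitCycle_of_fixed hstep ht' fun h => hw ((heq 1 0).1 h)) ⟨t, ht⟩⟩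
  · have hinj : Function.Injective u := fun s t hst =>
      hw'.resolve_left h ((heq s t).1 hst)
    exact ⟨iff_of_false (not_hasPeriodicOrbit hu hstep hinj) h,
      iff_of_false (not_hasLimitCycle hu hstep hinj) h⟩

/-! ### Transfer of undecidability -/

theorem computablePred_of_partrec {p : ℕ → Prop} {d : ℕ →. Bool} {c : ℕ → ℕ} (hd : Partrec d)
    (hc : Computable c) (h : ∀ i, (p i → true ∈ d (c i)) ∧ (¬ p i → false ∈ d (c i))) :
    ComputablePred p := by
  classical
  refine ⟨Classical.decPred p, Partrec.of_eq (hd.comp hc) fun i => ?_⟩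
  refine Part.eq_some_iff.2 ?_
  by_cases hi : p i
  · simpa [hi] using (h i).1 hi
  · simpa [hi] using (h i).2 hi

theorem not_decidableForCleanMaps {C : ActionModel (Fin k) (Fin m) → Prop}
    (hC : C A.toActionModel) (Λ : Set (Formula (Fin k) (Fin m)))
    (hsep : ∀ w w', (∀ φ, (model w).Sat φ ↔ (model w').Sat φ) → w = w')
    (hdes : ∀ x w, Bisimilar x (model w) →
      ∃! σ, σ ∈ A.toActionModel.designated ∧ x.Sat (A.toActionModel.pre σ))
    (hA : ∀ x w, Bisimilar x (model w) →
      Bisimilar (A.toActionModel.update x) (model (F w)))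
    {M : ℕ → FinModel k m} (hcode : Computable fun i => Presentation.code ⟨A, M i⟩)
    {w : ℕ → W} (hM : ∀ i, Bisimilar (M i).toPointedModel (model (w i)))
    (hund : ¬ ComputablePred fun i => ∃ t, F^[t + 1] (w i) = F^[t] (w i))
    (hw : ∀ i, F (w i) ≠ w i ∧ ((∃ t, F^[t + 1] (w i) = F^[t] (w i)) ∨
      Function.Injective fun t => F^[t] (w i))) :
    ¬ DecidableForCleanMaps Λ C (fun _ f => HasPeriodicOrbit f) ∧
      ¬ DecidableForCleanMaps Λ C (fun _ f => HasLimitCycle f) := by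
  refine ⟨fun ⟨d, hd, h⟩ => hund (computablePred_of_partrec hd hcode fun i => ?_),
    fun ⟨d, hd, h⟩ => hund (computablePred_of_partrec hd hcode fun i => ?_)⟩ <;>
  obtain ⟨f, hf⟩ := exists_cleanMap Λ hsep hdes hA (hM i)
  · rw [← (cleanMap_dichotomy hsep hA (hM i) (hw i).1 (hw i).2 hf).1]
    exact h ⟨A, M i⟩ f hC hf
  · rw [← (cleanMap_dichotomy hsep hA (hM i) (hw i).1 (hw i).2 hf).2]
    exact h ⟨A, M i⟩ f hC hf

end Representation

/-! ### Finite action models over an arbitrary finite type of actions -/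

section FiniteAction

variable {k m : ℕ} {T : Type} {N : ℕ}

open Classical in
/-- The finite action model with actions in `T`, where `T` is enumerated by `e`. -/
noncomputable def FinActionModel.ofEquiv (e : Fin (N + 1) ≃ T) (R : Fin k → T → T → Prop)
    (pre post : T → Formula (Fin k) (Fin m)) (hpost : ∀ τ, post τ = .top ∨ (post τ).IsClause)
    (D : List T) (hD : D ≠ []) : FinActionModel k m where
  last := N
  edges := ((Finset.univ : Finset (Fin k × Fin (N + 1) × Fin (N + 1))).filter
    fun a => R a.1 (e a.2.1) (e a.2.2)).toList.map fun a => (a.1, (a.2.1 : ℕ), (a.2.2 : ℕ))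
  pre σ := pre (e σ)
  post σ := post (e σ)
  post_wf σ := hpost (e σ)
  designated := D.map e.symm
  designated_ne_nil := by simpa using hD

theorem FinActionModel.ofEquiv_R (e : Fin (N + 1) ≃ T) (R : Fin k → T → T → Prop)
    (pre post : T → Formula (Fin k) (Fin m)) (hpost : ∀ τ, post τ = .top ∨ (post τ).IsClause)
    (D : List T) (hD : D ≠ []) (i : Fin k) (σ τ : Fin (N + 1)) :
    (ofEquiv e R pre post hpost D hD).toActionModel.R i σ τ ↔ R i (e σ) (e τ) := by
  simp only [toActionModel, ofEquiv, List.mem_map, Finset.mem_toList, Finset.mem_filter,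
    Finset.mem_univ, true_and, Prod.mk.injEq, Prod.exists]
  constructor
  · rintro ⟨i', σ', τ', h, rfl, h₁, h₂⟩
    rwa [← Fin.ext h₁, ← Fin.ext h₂]
  · exact fun h => ⟨i, σ, τ, h, rfl, rfl, rfl⟩

theorem FinActionModel.mem_ofEquiv_designated (e : Fin (N + 1) ≃ T) (R : Fin k → T → T → Prop)
    (pre post : T → Formula (Fin k) (Fin m)) (hpost : ∀ τ, post τ = .top ∨ (post τ).IsClause)
    (D : List T) (hD : D ≠ []) (σ : Fin (N + 1)) :
    σ ∈ (ofEquiv e R pre post hpost D hD).toActionModel.designated ↔ e σ ∈ D := by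
  change σ ∈ D.map e.symm ↔ e σ ∈ D
  simp [Equiv.symm_apply_eq]

/-- The product update with an action model, computed up to bisimilarity. -/
theorem FinActionModel.update_ofEquiv {e : Fin (N + 1) ≃ T} {R : Fin k → T → T → Prop}
    {pre post : T → Formula (Fin k) (Fin m)} {hpost : ∀ τ, post τ = .top ∨ (post τ).IsClause}
    {D : List T} {hD : D ≠ []} {x y : PointedModel (Fin k) (Fin m)} {τ₀ : T}
    (hτ₀ : ∀ τ, τ ∈ D ∧ x.Sat (pre τ) ↔ τ = τ₀)
    (Z : x.State → T → y.State → Prop) (hZ₀ : Z x.point τ₀ y.point)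
    (hV : ∀ s τ v, x.SatAt s (pre τ) → Z s τ v → ∀ p,
      ((x.V p s ∧ ¬ (post τ).Entails (.neg (.atom p))) ∨ (post τ).Entails (.atom p) ↔ y.V p v))
    (hforth : ∀ s τ v, x.SatAt s (pre τ) → Z s τ v → ∀ i s' τ', x.SatAt s' (pre τ') →
      x.R i s s' → R i τ τ' → ∃ v', y.R i v v' ∧ Z s' τ' v')
    (hback : ∀ s τ v, x.SatAt s (pre τ) → Z s τ v → ∀ i v', y.R i v v' →
      ∃ s' τ', x.SatAt s' (pre τ') ∧ x.R i s s' ∧ R i τ τ' ∧ Z s' τ' v') :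
    (∃! σ, σ ∈ (ofEquiv e R pre post hpost D hD).toActionModel.designated ∧
      x.Sat ((ofEquiv e R pre post hpost D hD).toActionModel.pre σ)) ∧
    Bisimilar ((ofEquiv e R pre post hpost D hD).toActionModel.update x) y := by
  have hdes : ∀ σ : Fin (N + 1), σ ∈ (ofEquiv e R pre post hpost D hD).toActionModel.designated ∧
      x.Sat (pre (e σ)) ↔ σ = e.symm τ₀ := fun σ => by
    rw [mem_ofEquiv_designated, hτ₀, Equiv.eq_symm_apply]
  have h₀ := (hdes (e.symm τ₀)).2 rfl
  refine ⟨⟨e.symm τ₀, h₀, fun σ hσ => (hdes σ).1 hσ⟩, ?_⟩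
  rw [ActionModel.update_eq_product _ h₀.1 h₀.2 fun τ h h' => (hdes τ).1 ⟨h, h'⟩]
  refine ⟨fun a v => Z a.1.1 (e a.1.2) v, ?_, ?_⟩
  · change Z x.point (e (e.symm τ₀)) y.point
    rwa [Equiv.apply_symm_apply]
  · rintro ⟨⟨s, σ⟩, hs⟩ v hv
    refine ⟨fun p => hV s (e σ) v hs hv p, ?_, ?_⟩
    · rintro i ⟨⟨s', σ'⟩, hs'⟩ ⟨h₁, h₂⟩
      exact hforth s (e σ) v hs hv i s' (e σ') hs' h₁ ((ofEquiv_R e R pre post hpost D hD _ _ _).1 h₂)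
    · intro i v' hv'
      obtain ⟨s', τ', h₁, h₂, h₃, h₄⟩ := hback s (e σ) v hs hv i v' hv'
      obtain ⟨σ', rfl⟩ := e.surjective τ'
      exact ⟨⟨(s', σ'), h₁⟩, ⟨h₂, (ofEquiv_R e R pre post hpost D hD _ _ _).2 h₃⟩, h₄⟩

theorem exists_equiv_fin_succ (T : Type) [Finite T] [Nonempty T] :
    ∃ N, Nonempty (Fin (N + 1) ≃ T) := by
  obtain ⟨n, ⟨e⟩⟩ := Finite.exists_equiv_fin T
  rcases n with - | n
  · exact (IsEmpty.false (e (Classical.arbitrary T))).elim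
  · exact ⟨n, ⟨e.symm⟩⟩

end FiniteAction

/-! ### Words as paths labelled by atoms -/

section Labelled

variable {n : ℕ}

/-- The path whose states are labelled with the letters of `w`. -/
def labelledPath (w : ℕ → Fin n) : PointedModel (Fin (n + 1)) (Fin n) where
  State := ℕ
  countable := inferInstance
  R i s t := i = 0 ∧ t = s + 1
  V p s := w s = p
  point := 0

theorem labelledPath_separated {w w' : ℕ → Fin n}
    (h : ∀ φ, (labelledPath w).Sat φ ↔ (labelledPath w').Sat φ) : w = w' := by
  have key : ∀ (w : ℕ → Fin n) (j : ℕ) (s : ℕ) (p : Fin n),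
      (labelledPath w).SatAt s ((Formula.box 0)^[j] (.atom p)) ↔ w (s + j) = p := by
    intro w j
    induction j with
    | zero => exact fun _ _ => Iff.rfl
    | succ j ih =>
      intro s p
      rw [Function.iterate_succ_apply', show s + (j + 1) = s + 1 + j by omega, ← ih]
      exact ⟨fun h => h (s + 1) ⟨rfl, rfl⟩, fun h t ht => ht.2 ▸ h⟩
  funext j
  have := h ((Formula.box 0)^[j] (.atom (w j)))
  have e := (key w j 0 (w j)).2 (by rw [Nat.zero_add])
  have e' := (key w' j 0 (w j)).1 (this.1 e)
  rw [Nat.zero_add] at e'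
  exact e'.symm

/-- The conjunction of literals that says that `b` and no other atom is true. -/
def letterClause (b : Fin n) : Formula (Fin (n + 1)) (Fin n) :=
  (List.finRange n).foldr
    (fun c φ => .and (if c = b then .atom c else .neg (.atom c)) φ) (.atom b)

/-- The fold ends in `.atom b` because `.top` is not a conjunction of literals. -/
theorem isClause_letterClause (b : Fin n) : (letterClause b).IsClause := by
  unfold letterClause
  induction List.finRange n with
  | nil => exact .pos b
  | cons c l ih =>
    refine .conj ?_ ih
    split_ifs
    exacts [.pos c, .negative c]

theorem sat_letterClause (x : PointedModel (Fin (n + 1)) (Fin n)) (b : Fin n) :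
    x.Sat (letterClause b) ↔ ∀ c, x.V c x.point ↔ c = b := by
  have key : ∀ l : List (Fin n), x.Sat (l.foldr
      (fun c φ => .and (if c = b then .atom c else .neg (.atom c)) φ) (.atom b)) ↔
        x.V b x.point ∧ ∀ c ∈ l, (x.V c x.point ↔ c = b) := by
    intro l
    induction l with
    | nil => exact ⟨fun h => ⟨h, by simp⟩, fun h => h.1⟩
    | cons c l ih =>
      rw [List.foldr_cons, List.forall_mem_cons]
      change x.Sat _ ∧ x.Sat _ ↔ _
      rw [ih]
      have : x.Sat (if c = b then .atom c else .neg (.atom c)) ↔ (x.V c x.point ↔ c = b) := by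
        split_ifs with h
        · exact (iff_true_right h).symm
        · exact (iff_false_right h).symm
      rw [this]
      tauto
  refine (key _).trans ⟨fun h c => h.2 c (List.mem_finRange c), fun h => ⟨(h b).2 rfl, fun c _ => h c⟩⟩

theorem letterClause_entails (b p : Fin n) :
    ((letterClause b).Entails (.atom p) ↔ b = p) ∧
      ((letterClause b).Entails (.neg (.atom p)) ↔ b ≠ p) := by
  -- A model of the clause, which shows that it entails no further literals.
  let x : PointedModel (Fin (n + 1)) (Fin n) := ⟨Unit, inferInstance, fun _ _ _ => False,
    fun c _ => c = b, ()⟩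
  have hx : x.Sat (letterClause b) := (sat_letterClause x b).2 fun _ => Iff.rfl
  refine ⟨⟨fun h => (h x hx : p = b).symm, fun h y hy => ((sat_letterClause y b).1 hy p).2 h.symm⟩,
    fun h hb => (h x hx : ¬ p = b) hb.symm, fun h y hy => ?_⟩
  exact fun hp => h (((sat_letterClause y b).1 hy p).1 hp).symm

/-- The overlap relation between windows of a word. -/
def Overlap (σ τ : Fin n × Fin n × Fin n) : Prop := τ.1 = σ.2.1 ∧ τ.2.1 = σ.2.2

/-- The window of the word `w` at place `j`. -/
def window (z : Fin n) (w : ℕ → Fin n) (j : ℕ) : Fin n × Fin n × Fin n :=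
  (shiftWord z (shiftWord z w) j, shiftWord z w j, w j)

/-- The previous window and the current letter determine the current window: this is why only one
action can be reached at each place. -/
theorem overlap_window_iff (z : Fin n) (w : ℕ → Fin n) (j : ℕ) (τ : Fin n × Fin n × Fin n) :
    Overlap (window z w j) τ ∧ w (j + 1) = τ.2.2 ↔ τ = window z w (j + 1) := by
  obtain ⟨a, b, c⟩ := τ
  simp only [Overlap, window, shiftWord, Prod.mk.injEq]
  tauto

/-- The action model that applies a one-sided cellular automaton to the labels of a path. -/
noncomputable def labelledAction {N : ℕ} (e : Fin (N + 1) ≃ Fin n × Fin n × Fin n)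
    (g : Fin n → Fin n → Fin n → Fin n) (z : Fin n) : FinActionModel (n + 1) n :=
  .ofEquiv e (fun i σ τ => i = 0 ∧ Overlap σ τ) (fun τ => .atom τ.2.2)
    (fun τ => letterClause (g τ.1 τ.2.1 τ.2.2)) (fun _ => .inr (isClause_letterClause _))
    ((List.finRange n).map fun c => (z, z, c))
    (by simpa using fun h : n = 0 => (h ▸ z).elim0)

/-- The reachable part of the product pairs each place with its own window: the designated actions
`(z, z, c)` fix the first window, and overlaps propagate. The context of a cell is remembered by the
action, so the precondition needs no modality. -/
theorem labelledAction_update {N : ℕ} (e : Fin (N + 1) ≃ Fin n × Fin n × Fin n)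
    (g : Fin n → Fin n → Fin n → Fin n) (z : Fin n) {x : PointedModel (Fin (n + 1)) (Fin n)}
    {w : ℕ → Fin n} (hx : Bisimilar x (labelledPath w)) :
    (∃! σ, σ ∈ (labelledAction e g z).toActionModel.designated ∧
      x.Sat ((labelledAction e g z).toActionModel.pre σ)) ∧
    Bisimilar ((labelledAction e g z).toActionModel.update x) (labelledPath (oneSided g z w)) := by
  obtain ⟨Z, hZ₀, hZ⟩ := hx
  have hV : ∀ {s : x.State} {j : ℕ}, Z s j → ∀ {p}, x.V p s ↔ w j = p :=
    fun {s j} h {p} => (hZ s j h).1 p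
  refine FinActionModel.update_ofEquiv (τ₀ := (z, z, w 0)) ?_
    (fun s τ j => Z s j ∧ τ = window z w j) ⟨hZ₀, rfl⟩ ?_ ?_ ?_
  · rintro ⟨a, b, c⟩
    have : x.Sat (.atom c) ↔ w 0 = c := hV hZ₀
    simp only [this, List.mem_map, List.mem_finRange, true_and, Prod.mk.injEq, exists_eq_right_right]
    tauto
  · rintro s τ (j : ℕ) - ⟨-, rfl⟩ p
    rw [(letterClause_entails _ _).1, (letterClause_entails _ _).2]
    change _ ↔ oneSided g z w j = p
    simp only [oneSided, window]
    tauto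
  · rintro s τ (j : ℕ) - ⟨hs, rfl⟩ i s' τ' hτ' hss' ⟨rfl, ho⟩
    obtain ⟨j', ⟨-, rfl⟩, hj'⟩ := (hZ s j hs).2.1 0 s' hss'
    exact ⟨j + 1, ⟨rfl, rfl⟩, hj', (overlap_window_iff z w j τ').1 ⟨ho, (hV hj').1 hτ'⟩⟩
  · rintro s τ (j : ℕ) - ⟨hs, rfl⟩ i (j' : ℕ) ⟨rfl, rfl⟩
    obtain ⟨s', hss', hs'⟩ := (hZ s j hs).2.2 0 (j + 1) ⟨rfl, rfl⟩
    have h := (overlap_window_iff z w j _).2 rfl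
    exact ⟨s', window z w (j + 1), (hV hs').2 h.2, hss', ⟨rfl, h.1⟩, hs', rfl⟩

theorem labelledAction_isBoolean {N : ℕ} (e : Fin (N + 1) ≃ Fin n × Fin n × Fin n)
    (g : Fin n → Fin n → Fin n → Fin n) (z : Fin n) :
    (labelledAction e g z).toActionModel.IsBoolean ∧
      ¬ (labelledAction e g z).toActionModel.IsStatic := by
  refine ⟨fun _ => trivial, fun h => ?_⟩
  have h₀ : letterClause _ = .top := h (0 : Fin (N + 1))
  have := isClause_letterClause (g (e 0).1 (e 0).2.1 (e 0).2.2)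
  rw [h₀] at this
  cases this

end Labelled

/-! ### Words as paths with pointers to a terminal state -/

section Pointers

variable {n : ℕ}

/-- The path in which each state has loops for all agents `a.succ`, and an arrow for the agent
given by its letter in `w` to a terminal state. -/
def pointerPath (w : ℕ → Fin n) : PointedModel (Fin (n + 1)) (Fin n) where
  State := Option ℕ
  countable := inferInstance
  R i s t := match s, t with
    | some s, some t => if i = 0 then t = s + 1 else t = s
    | some s, none => i = (w s).succ
    | none, _ => False
  V _ _ := False
  point := some 0

theorem pointerPath_R_some_some (w : ℕ → Fin n) (i : Fin (n + 1)) (s t : ℕ) :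
    (pointerPath w).R i (some s) (some t) ↔ i = 0 ∧ t = s + 1 ∨ i ≠ 0 ∧ t = s := by
  change (if i = 0 then t = s + 1 else t = s) ↔ _
  split_ifs <;> simp_all

theorem top_not_entails_atom (p : Fin n) :
    ¬ (Formula.top : Formula (Fin (n + 1)) (Fin n)).Entails (.atom p) := fun h =>
  h ⟨Unit, inferInstance, fun _ _ _ => False, fun _ _ => False, ()⟩ trivial

/-- The formula that says that the agent for the letter `c` has an arrow to a state without
arrows for this agent. -/
def letterFormula (c : Fin n) : Formula (Fin (n + 1)) (Fin n) :=
  .neg (.box c.succ (.neg (.box c.succ (.neg .top))))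

/-- Owing to the loops, the terminal state is the only one without arrows for agent `c.succ`. -/
theorem satAt_letterFormula (w : ℕ → Fin n) (s : Option ℕ) (c : Fin n) :
    (pointerPath w).SatAt s (letterFormula c) ↔ ∃ j, s = some j ∧ w j = c := by
  have h₁ : ∀ t : Option ℕ, (pointerPath w).SatAt t (.box c.succ (.neg .top)) ↔ t = none := by
    rintro (_ | j)
    · exact ⟨fun _ => rfl, fun _ _ h => h.elim⟩
    · refine ⟨fun h => (h (some j) ?_ trivial).elim, fun h => by cases h⟩
      exact ((pointerPath_R_some_some w _ j j).2 (.inr ⟨Fin.succ_ne_zero c, rfl⟩))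
  have h₂ : (pointerPath w).SatAt s (letterFormula c) ↔
      ∃ t, (pointerPath w).R c.succ s t ∧
        (pointerPath w).SatAt t (.box c.succ (.neg .top)) := by
    change (¬ ∀ t, (pointerPath w).R c.succ s t → ¬ _) ↔ _
    push Not
    rfl
  rw [h₂]
  constructor
  · rintro ⟨t, h, ht⟩
    obtain rfl := (h₁ t).1 ht
    rcases s with - | j
    · exact h.elim
    · exact ⟨j, rfl, (Fin.succ_injective _ h).symm⟩
  · rintro ⟨j, rfl, rfl⟩
    exact ⟨none, rfl, (h₁ none).2 rfl⟩

theorem pointerPath_separated {w w' : ℕ → Fin n}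
    (h : ∀ φ, (pointerPath w).Sat φ ↔ (pointerPath w').Sat φ) : w = w' := by
  have key : ∀ (w : ℕ → Fin n) (j : ℕ) (s : ℕ) (p : Fin n),
      (pointerPath w).SatAt (some s)
        ((fun φ => .neg (.box 0 (.neg φ)))^[j] (letterFormula p)) ↔ w (s + j) = p := by
    intro w j
    induction j with
    | zero =>
      intro s p
      rw [Function.iterate_zero_apply, satAt_letterFormula]
      simp
    | succ j ih =>
      intro s p
      rw [Function.iterate_succ_apply', show s + (j + 1) = s + 1 + j by omega, ← ih]
      change (¬ ∀ t, (pointerPath w).R 0 (some s) t → ¬ _) ↔ _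
      push Not
      constructor
      · rintro ⟨_ | t, ht, h⟩
        · exact absurd ht (Fin.succ_ne_zero _).symm
        · have ht : t = s + 1 := ht
          subst ht
          exact h
      · exact fun h => ⟨some (s + 1), rfl, h⟩
  funext j
  have := h ((fun φ => .neg (.box 0 (.neg φ)))^[j] (letterFormula (w j)))
  have e := (key w j 0 (w j)).2 (by rw [Nat.zero_add])
  have e' := (key w' j 0 (w j)).1 (this.1 e)
  rw [Nat.zero_add] at e'
  exact e'.symm

/-- The action model that applies a one-sided cellular automaton to the pointers of a path; the
action `none` produces terminal states. -/
noncomputable def pointerAction {N : ℕ} (e : Fin (N + 1) ≃ Option (Fin n × Fin n × Fin n))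
    (g : Fin n → Fin n → Fin n → Fin n) (z : Fin n) : FinActionModel (n + 1) n :=
  .ofEquiv e
    (fun i σ τ => match σ, τ with
      | some σ, some τ => if i = 0 then Overlap σ τ else σ = τ
      | some σ, none => i = (g σ.1 σ.2.1 σ.2.2).succ
      | none, _ => False)
    (fun τ => match τ with
      | some τ => letterFormula τ.2.2
      | none => .top)
    (fun _ => .top) (fun _ => .inl rfl)
    ((List.finRange n).map fun c => some (z, z, c))
    (by simpa using fun h : n = 0 => (h ▸ z).elim0)

/-- The loops of the path supply, for any agent other than `0`, an arrow that combines with the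
arrow from a window to `none`; this makes the new pointer. States with action `none` have no arrows
and no atoms, so it is irrelevant which old state they come from. The old terminal state satisfies
no letter formula and survives only with action `none`. -/
theorem pointerAction_update {N : ℕ} (e : Fin (N + 1) ≃ Option (Fin n × Fin n × Fin n))
    (g : Fin n → Fin n → Fin n → Fin n) (z : Fin n) {x : PointedModel (Fin (n + 1)) (Fin n)}
    {w : ℕ → Fin n} (hx : Bisimilar x (pointerPath w)) :
    (∃! σ, σ ∈ (pointerAction e g z).toActionModel.designated ∧
      x.Sat ((pointerAction e g z).toActionModel.pre σ)) ∧
    Bisimilar ((pointerAction e g z).toActionModel.update x) (pointerPath (oneSided g z w)) := by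
  obtain ⟨Z, hZ₀, hZ⟩ := hx
  have hV : ∀ {s : x.State} {v : Option ℕ}, Z s v → ∀ c, x.SatAt s (letterFormula c) ↔
      ∃ j, v = some j ∧ w j = c := fun h c =>
    (satAt_iff_of_bisimulation hZ _ h).trans (satAt_letterFormula w _ c)
  refine FinActionModel.update_ofEquiv (τ₀ := some (z, z, w 0)) ?_
    (fun s τ v => match τ, v with
      | some τ, some j => Z s (some j) ∧ τ = window z w j
      | none, none => ∀ p, ¬ x.V p s
      | _, _ => False) ⟨hZ₀, rfl⟩ ?_ ?_ ?_
  · rintro (_ | ⟨a, b, c⟩)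
    · simp
    · have : x.Sat (letterFormula c) ↔ w 0 = c := by
        refine (hV hZ₀ c).trans ⟨?_, fun h => ⟨0, rfl, h⟩⟩
        rintro ⟨j, h, rfl⟩
        cases h
        rfl
      simp only [this, List.mem_map, List.mem_finRange, true_and, Prod.mk.injEq, Option.some.injEq,
        exists_eq_right_right]
      tauto
  · intro s τ v _ hs p
    have hp : ¬ x.V p s := by
      rcases τ with - | τ <;> rcases v with - | j
      exacts [hs p, hs.elim, hs.elim, fun h => ((hZ s _ hs.1).1 p).1 h]
    exact iff_of_false (not_or_intro (fun h => hp h.1) (top_not_entails_atom p)) id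
  · rintro s (_ | τ) (_ | j) - hs i s' τ' hτ' hss' hR
    · exact hR.elim
    · exact hs.elim
    · exact hs.elim
    · obtain ⟨hs, rfl⟩ := hs
      obtain ⟨v, hv, hsv⟩ := (hZ s (some j) hs).2.1 i s' hss'
      rcases τ' with - | τ'
      · exact ⟨none, hR, fun p h => ((hZ s' v hsv).1 p).1 h⟩
      · obtain ⟨j', rfl, hj'⟩ := (hV hsv _).1 hτ'
        refine ⟨some j', (pointerPath_R_some_some _ _ _ _).2
          ((pointerPath_R_some_some w _ _ _).1 hv), hsv, ?_⟩
        rcases (pointerPath_R_some_some w _ _ _).1 hv with ⟨rfl, rfl⟩ | ⟨hi, rfl⟩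
        · exact (overlap_window_iff z w j τ').1 ⟨hR, hj'⟩
        · exact ((if_neg hi).mp hR).symm
  · rintro s (_ | τ) (_ | j) - hs i v hv
    · exact hv.elim
    · exact hs.elim
    · exact hs.elim
    · obtain ⟨hs, rfl⟩ := hs
      rcases v with - | j'
      · have hi : i = (oneSided g z w j).succ := hv
        obtain ⟨s', hss', hs'⟩ := (hZ s (some j) hs).2.2 i (some j)
          ((pointerPath_R_some_some w _ _ _).2 (.inr ⟨hi ▸ Fin.succ_ne_zero _, rfl⟩))
        exact ⟨s', none, trivial, hss', hi, fun p h => ((hZ s' _ hs').1 p).1 h⟩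
      · obtain ⟨s', hss', hs'⟩ := (hZ s (some j) hs).2.2 i (some j')
          ((pointerPath_R_some_some w _ _ _).2 ((pointerPath_R_some_some _ _ _ _).1 hv))
        refine ⟨s', some (window z w j'), (hV hs' _).2 ⟨j', rfl, rfl⟩, hss', ?_, hs', rfl⟩
        rcases (pointerPath_R_some_some _ _ _ _).1 hv with ⟨rfl, rfl⟩ | ⟨hi, rfl⟩
        · exact ((overlap_window_iff z w j _).2 rfl).1
        · exact (if_neg hi).mpr rfl

theorem pointerAction_isStatic {N : ℕ} (e : Fin (N + 1) ≃ Option (Fin n × Fin n × Fin n))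
    (g : Fin n → Fin n → Fin n → Fin n) (z : Fin n) :
    (pointerAction e g z).toActionModel.IsStatic ∧
      ¬ (pointerAction e g z).toActionModel.IsBoolean := by
  refine ⟨fun _ => rfl, fun h => ?_⟩
  have h₀ := h (e.symm (some (z, z, z)))
  simp only [pointerAction, FinActionModel.toActionModel, FinActionModel.ofEquiv,
    Equiv.apply_symm_apply] at h₀
  exact h₀

end Pointers

/-! ### Finite initial models -/

section Initial

variable {n : ℕ} (a₀ a₁ a₂ b : Fin n)

/-- From place `k + 2` on every letter is `b`, so a finite path may end in a loop at state `k + 2`.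
-/
theorem inputWord_min {C : Type*} (a₀ a₁ a₂ b : C) (k j : ℕ) :
    inputWord a₀ a₁ a₂ b k (min j (k + 2)) = inputWord a₀ a₁ a₂ b k j := by
  rcases le_total j (k + 2) with h | h
  · rw [min_eq_left h]
  · rw [min_eq_right h]
    obtain ⟨i, rfl⟩ := Nat.exists_eq_add_of_le h
    rw [show k + 2 + i = k + i + 2 by omega]
    simp [inputWord]

theorem primrec_inputWord {α : Type*} [Primcodable α] {k i : α → ℕ} (hk : Primrec k)
    (hi : Primrec i) : Primrec fun x => inputWord a₀ a₁ a₂ b (k x) (i x) := by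
  have h : ∀ x, inputWord a₀ a₁ a₂ b (k x) (i x) = if i x = 0 then a₀ else if i x = 1 then a₁ else
      if i x < k x + 2 then a₂ else b := fun x => by
    rcases i x with - | - | j
    · rfl
    · rfl
    · simp [inputWord]
  refine (Primrec.ite (Primrec.eq.comp hi (Primrec.const 0)) (Primrec.const a₀)
    (Primrec.ite (Primrec.eq.comp hi (Primrec.const 1)) (Primrec.const a₁)
      (Primrec.ite (Primrec.nat_lt.comp hi (Primrec.nat_add.comp hk (Primrec.const 2)))
        (Primrec.const a₂) (Primrec.const b)))).of_eq fun x => (h x).symm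

/-- The arrows of a path with states `0, …, k + 2` and a loop at its end. -/
def pathEdges (n k : ℕ) : List (Fin (n + 1) × ℕ × ℕ) :=
  (List.range (k + 3)).map fun i => (0, i, min (i + 1) (k + 2))

/-- The loops for all agents `a.succ` at the states `0, …, k + 2`. -/
def loopEdges (n k : ℕ) : List (Fin (n + 1) × ℕ × ℕ) :=
  (List.range (k + 3)).flatMap fun i => (List.finRange n).map fun a => (a.succ, i, i)

/-- The arrows from the states `0, …, k + 2` to a terminal state that represent the letters
of a word. -/
def pointerEdges (k : ℕ) : List (Fin (n + 1) × ℕ × ℕ) :=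
  (List.range (k + 3)).map fun i => ((inputWord a₀ a₁ a₂ b k i).succ, i, k + 3)

theorem mem_pathEdges {k : ℕ} {i : Fin (n + 1)} {s t : ℕ} :
    (i, s, t) ∈ pathEdges n k ↔ i = 0 ∧ s < k + 3 ∧ t = min (s + 1) (k + 2) := by
  simp only [pathEdges, List.mem_map, List.mem_range, Prod.mk.injEq]
  constructor
  · rintro ⟨j, hj, rfl, rfl, rfl⟩
    exact ⟨rfl, hj, rfl⟩
  · rintro ⟨rfl, hs, rfl⟩
    exact ⟨s, hs, rfl, rfl, rfl⟩

theorem mem_loopEdges {k : ℕ} {i : Fin (n + 1)} {s t : ℕ} :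
    (i, s, t) ∈ loopEdges n k ↔ i ≠ 0 ∧ s < k + 3 ∧ t = s := by
  simp only [loopEdges, List.mem_flatMap, List.mem_map, List.mem_range, Prod.mk.injEq,
    List.mem_finRange, true_and]
  constructor
  · rintro ⟨j, hj, a, rfl, rfl, rfl⟩
    exact ⟨Fin.succ_ne_zero a, hj, rfl⟩
  · rintro ⟨hi, hs, rfl⟩
    obtain ⟨a, rfl⟩ := Fin.exists_succ_eq.2 hi
    exact ⟨t, hs, a, rfl, rfl, rfl⟩

theorem mem_pointerEdges {k : ℕ} {i : Fin (n + 1)} {s t : ℕ} :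
    (i, s, t) ∈ pointerEdges a₀ a₁ a₂ b k ↔
      i = (inputWord a₀ a₁ a₂ b k s).succ ∧ s < k + 3 ∧ t = k + 3 := by
  simp only [pointerEdges, List.mem_map, List.mem_range, Prod.mk.injEq]
  constructor
  · rintro ⟨j, hj, rfl, rfl, rfl⟩
    exact ⟨rfl, hj, rfl⟩
  · rintro ⟨rfl, hs, rfl⟩
    exact ⟨s, hs, rfl, rfl, rfl⟩

theorem primrec_pathEdges : Primrec (pathEdges n) := by
  have h : Primrec₂ fun k i : ℕ => ((0 : Fin (n + 1)), i, min (i + 1) (k + 2)) :=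
    Primrec.pair (.const 0) (Primrec.pair .snd (Primrec.nat_min.comp
      (Primrec.succ.comp .snd) (Primrec.nat_add.comp .fst (.const 2))))
  exact Primrec.list_map (Primrec.list_range.comp (Primrec.nat_add.comp .id (.const 3))) h

theorem primrec_loopEdges : Primrec (loopEdges n) := by
  have h : Primrec₂ fun (x : ℕ × ℕ) (a : Fin n) => (a.succ, x.2, x.2) :=
    Primrec.pair ((Primrec.dom_finite (Fin.succ : Fin n → Fin (n + 1))).comp .snd)
      (Primrec.pair (Primrec.snd.comp .fst) (Primrec.snd.comp .fst))
  have h' : Primrec₂ fun (_ i : ℕ) => (List.finRange n).map fun a => (a.succ, i, i) :=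
    Primrec.list_map (.const (List.finRange n)) h
  exact Primrec.list_flatMap (Primrec.list_range.comp (Primrec.nat_add.comp .id (.const 3))) h'

theorem primrec_pointerEdges : Primrec (pointerEdges a₀ a₁ a₂ b) := by
  refine Primrec.list_map (Primrec.list_range.comp (Primrec.nat_add.comp .id (.const 3))) ?_
  exact (((Primrec.dom_finite (Fin.succ : Fin n → Fin (n + 1))).comp
    (primrec_inputWord a₀ a₁ a₂ b .fst .snd)).pair
      (Primrec.snd.pair (Primrec.nat_add.comp .fst (.const 3)))).to₂

/-- A finite labelled path that unravels to the path labelled with an input word. -/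
def labelledInit (k : ℕ) : FinModel (n + 1) n where
  last := k + 2
  edges := pathEdges n k
  labels := (List.range (k + 3)).map fun i => (inputWord a₀ a₁ a₂ b k i, i)
  point := 0

/-- A finite path with pointers that unravels to the path with pointers for an input word. -/
def pointerInit (k : ℕ) : FinModel (n + 1) n where
  last := k + 3
  edges := pathEdges n k ++ (loopEdges n k ++ pointerEdges a₀ a₁ a₂ b k)
  labels := []
  point := 0

theorem bisimilar_labelledInit (k : ℕ) :
    Bisimilar (labelledInit a₀ a₁ a₂ b k).toPointedModel
      (labelledPath (inputWord a₀ a₁ a₂ b k)) := by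
  refine ⟨fun (s : Fin (k + 3)) (j : ℕ) => (s : ℕ) = min j (k + 2), rfl, ?_⟩
  intro (s : Fin (k + 3)) (j : ℕ) hs
  refine ⟨fun p => ?_, ?_, ?_⟩
  · change (p, (s : ℕ)) ∈ (List.range (k + 3)).map _ ↔ inputWord a₀ a₁ a₂ b k j = p
    simp only [List.mem_map, List.mem_range, Prod.mk.injEq]
    rw [← inputWord_min, ← hs]
    constructor
    · rintro ⟨i, -, h, rfl⟩
      exact h
    · exact fun h => ⟨s, s.2, h, rfl⟩
  · intro i (s' : Fin (k + 3)) h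
    obtain ⟨rfl, -, h⟩ := mem_pathEdges.1 h
    exact ⟨j + 1, ⟨rfl, rfl⟩, by omega⟩
  · rintro i _ ⟨rfl, rfl⟩
    exact ⟨(⟨min (s + 1) (k + 2), by omega⟩ : Fin (k + 3)),
      mem_pathEdges.2 ⟨rfl, s.2, rfl⟩, show min ((s : ℕ) + 1) (k + 2) = min (j + 1) (k + 2) by omega⟩

theorem bisimilar_pointerInit (k : ℕ) :
    Bisimilar (pointerInit a₀ a₁ a₂ b k).toPointedModel
      (pointerPath (inputWord a₀ a₁ a₂ b k)) := by
  have hR : ∀ (i : Fin (n + 1)) (s t : Fin (k + 4)),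
      (pointerInit a₀ a₁ a₂ b k).toPointedModel.R i s t ↔ (s : ℕ) < k + 3 ∧
        ((i = 0 ∧ (t : ℕ) = min ((s : ℕ) + 1) (k + 2)) ∨ (i ≠ 0 ∧ (t : ℕ) = s) ∨
          (i = (inputWord a₀ a₁ a₂ b k s).succ ∧ (t : ℕ) = k + 3)) := fun i s t => by
    change _ ∈ _ ++ (_ ++ _) ↔ _
    rw [List.mem_append, List.mem_append, mem_pathEdges, mem_loopEdges, mem_pointerEdges]
    tauto
  refine ⟨fun (s : Fin (k + 4)) v => match v with
    | some j => (s : ℕ) = min j (k + 2)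
    | none => (s : ℕ) = k + 3, rfl, ?_⟩
  intro (s : Fin (k + 4)) v hs
  refine ⟨fun p => iff_of_false (fun h => by cases h) id, ?_, ?_⟩
  · intro i (s' : Fin (k + 4)) h
    obtain ⟨hlt, h⟩ := (hR i s s').1 h
    rcases v with - | j
    · have hs : (s : ℕ) = k + 3 := hs
      omega
    · have hs : (s : ℕ) = min j (k + 2) := hs
      rcases h with ⟨rfl, h⟩ | ⟨hi, h⟩ | ⟨hi, h⟩
      · exact ⟨some (j + 1), rfl, show (s' : ℕ) = min (j + 1) (k + 2) by omega⟩
      · exact ⟨some j, (pointerPath_R_some_some _ _ _ _).2 (.inr ⟨hi, rfl⟩), h.trans hs⟩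
      · exact ⟨none, by rwa [hs, inputWord_min] at hi, h⟩
  · intro i v' hv
    rcases v with - | j
    · exact hv.elim
    have hs : (s : ℕ) = min j (k + 2) := hs
    have hlt : (s : ℕ) < k + 3 := by omega
    rcases v' with - | j'
    · refine ⟨(⟨k + 3, by omega⟩ : Fin (k + 4)), (hR _ _ _).2 ⟨hlt, .inr (.inr ⟨?_, rfl⟩)⟩, rfl⟩
      rw [hs, inputWord_min]
      exact hv
    · rcases (pointerPath_R_some_some _ _ _ _).1 hv with ⟨rfl, rfl⟩ | ⟨hi, rfl⟩
      · exact ⟨(⟨min (s + 1) (k + 2), by omega⟩ : Fin (k + 4)),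
          (hR _ _ _).2 ⟨hlt, .inl ⟨rfl, rfl⟩⟩,
          show min ((s : ℕ) + 1) (k + 2) = min (j + 1) (k + 2) by omega⟩
      · exact ⟨s, (hR _ _ _).2 ⟨hlt, .inr (.inl ⟨hi, rfl⟩)⟩, hs⟩

/-! ### Computability of the codes -/

/-- Only the initial model varies with `i`. The action model contributes a constant, so it does not
matter that it was obtained by choice. -/
theorem computable_code {k m : ℕ} (A : FinActionModel k m) {M : ℕ → FinModel k m}
    (hlast : Primrec fun i => (M i).last) (hedges : Primrec fun i => (M i).edges)
    (hlabels : Primrec fun i => (M i).labels) (hpoint : Primrec fun i => ((M i).point : ℕ)) :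
    Computable fun i => Presentation.code ⟨A, M i⟩ :=
  (Primrec.encode.comp ((Primrec.const (A.last, A.edges,
    List.ofFn fun σ => (A.pre σ).code, List.ofFn fun σ => (A.post σ).code,
    A.designated.map Fin.val)).pair (hlast.pair (hedges.pair (hlabels.pair hpoint))))).to_comp

theorem computable_code_labelledInit (A : FinActionModel (n + 1) n) :
    Computable fun k => Presentation.code ⟨A, labelledInit a₀ a₁ a₂ b k⟩ := by
  refine computable_code A (Primrec.nat_add.comp .id (.const 2)) primrec_pathEdges ?_ (.const 0)
  refine Primrec.list_map (Primrec.list_range.comp (Primrec.nat_add.comp .id (.const 3))) ?_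
  exact ((primrec_inputWord a₀ a₁ a₂ b .fst .snd).pair .snd).to₂

theorem computable_code_pointerInit (A : FinActionModel (n + 1) n) :
    Computable fun k => Presentation.code ⟨A, pointerInit a₀ a₁ a₂ b k⟩ :=
  computable_code A (Primrec.nat_add.comp .id (.const 3))
    (Primrec.list_append.comp primrec_pathEdges
      (Primrec.list_append.comp primrec_loopEdges (primrec_pointerEdges a₀ a₁ a₂ b)))
    (.const []) (.const 0)

end Initial

end CleanMaps

/-- Over a suitable finite language, and for every logic over it: for Boolean and non-static clean
maps, and for static and non-Boolean clean maps, it is undecidable whether the map has a periodic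
orbit, and it is undecidable whether the map contains a limit cycle. -/
theorem mainTheorem9 :
    ∃ k m : ℕ, ∀ Λ : Set (CleanMaps.Formula (Fin k) (Fin m)), CleanMaps.IsLogic Λ →
      (¬ CleanMaps.DecidableForCleanMaps Λ (fun A => A.IsBoolean ∧ ¬ A.IsStatic)
          (fun _ f => CleanMaps.HasPeriodicOrbit f)) ∧
      (¬ CleanMaps.DecidableForCleanMaps Λ (fun A => A.IsBoolean ∧ ¬ A.IsStatic)
          (fun _ f => CleanMaps.HasLimitCycle f)) ∧
      (¬ CleanMaps.DecidableForCleanMaps Λ (fun A => A.IsStatic ∧ ¬ A.IsBoolean)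
          (fun _ f => CleanMaps.HasPeriodicOrbit f)) ∧
      (¬ CleanMaps.DecidableForCleanMaps Λ (fun A => A.IsStatic ∧ ¬ A.IsBoolean)
          (fun _ f => CleanMaps.HasLimitCycle f)) := by
  obtain ⟨n, g, z, a₀, a₁, a₂, b, hund, hw⟩ := CleanMaps.exists_oneSided_undecidable
  have : Nonempty (Fin n) := ⟨z⟩
  obtain ⟨_, ⟨e⟩⟩ := CleanMaps.exists_equiv_fin_succ (Fin n × Fin n × Fin n)
  obtain ⟨_, ⟨e'⟩⟩ := CleanMaps.exists_equiv_fin_succ (Option (Fin n × Fin n × Fin n))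
  -- One language serves both classes: labelled paths have arrows for agent `0` only, and pointer
  -- paths make no atom true.
  refine ⟨n + 1, n, fun Λ _ => ?_⟩
  rw [← and_assoc]
  exact ⟨CleanMaps.not_decidableForCleanMaps (CleanMaps.labelledAction_isBoolean e g z) Λ
      (fun _ _ => CleanMaps.labelledPath_separated)
      (fun _ _ h => (CleanMaps.labelledAction_update e g z h).1)
      (fun _ _ h => (CleanMaps.labelledAction_update e g z h).2)
      (CleanMaps.computable_code_labelledInit a₀ a₁ a₂ b _)
      (CleanMaps.bisimilar_labelledInit a₀ a₁ a₂ b) hund hw,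
    CleanMaps.not_decidableForCleanMaps (CleanMaps.pointerAction_isStatic e' g z) Λ
      (fun _ _ => CleanMaps.pointerPath_separated)
      (fun _ _ h => (CleanMaps.pointerAction_update e' g z h).1)
      (fun _ _ h => (CleanMaps.pointerAction_update e' g z h).2)
      (CleanMaps.computable_code_pointerInit a₀ a₁ a₂ b _)
      (CleanMaps.bisimilar_pointerInit a₀ a₁ a₂ b) hund hw⟩
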